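/- For $n \ge 1$, let $K_n^{(3)}$ be the complete 3-uniform hypergraph on $n$ vertices, and let $L_n^{(3)}$ be the star 3-uniform hypergraph on $n+1$ vertices whose edges are the $\binom{n}{2}$ triples containing one given vertex. For 3-uniform hypergraphs $H_1, H_2$, let $r(H_1,H_2)$ be the smallest positive integer $N$ such that every 3-uniform hypergraph $G$ on $N$ vertices contains $H_1$ as a (not necessarily induced) subgraph or its complement $\overline{G}$ contains $H_2$ as a subgraph. Logarithms are base 2. Theorem 1.2. There are positive constants $c$ and $c'$ such that for every integer $n \ge 2$ $$2^{c \log^2 n} \le r(K_4^{(3)}, L_n^{(3)}) \le 2^{c' n^{2/3} \log n}.$$ Moreover, for each integer $s \ge 5$ there are positive constants $c_s$ and $c'_s$ such that for every integer $n \ge 1$ $$2^{c_s n} \le r(K_s^{(3)}, L_n^{(3)}) \le 2^{c'_s n}.$$ -/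

import Mathlib

/-- A `k`-uniform hypergraph (`k`-graph) with vertex set `V`: a set of `k`-element subsets of `V`. -/
@[ext]
structure UniformHypergraph (k : ℕ) (V : Type*) where
  /-- The set of edges. -/
  edges : Set (Finset V)
  /-- Every edge has exactly `k` vertices. -/
  card_eq : ∀ e ∈ edges, e.card = k

namespace UniformHypergraph

/-- The complement: its edges are the `k`-element sets of vertices that are not edges of `G`. -/
def compl {k : ℕ} {V : Type*} (G : UniformHypergraph k V) : UniformHypergraph k V where
  edges := {e | e.card = k ∧ e ∉ G.edges}
  card_eq := fun _ he => he.1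

/-- `G` contains `H` as a (not necessarily induced) subgraph: some injection of the vertices of `H`
into the vertices of `G` maps every edge of `H` onto an edge of `G`. -/
def Contains {k : ℕ} {V W : Type*} (G : UniformHypergraph k V) (H : UniformHypergraph k W) :
    Prop :=
  ∃ f : W ↪ V, ∀ e ∈ H.edges, e.map f ∈ G.edges

/-- The complete `k`-graph `K_n^{(k)}` on `n` vertices. -/
def complete (k n : ℕ) : UniformHypergraph k (Fin n) where
  edges := {e | e.card = k}
  card_eq := fun _ he => he

/-- The star `3`-graph `L_n^{(3)}` on `n + 1` vertices, whose edges are all the triples that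
contain the given vertex `0`. -/
def star (n : ℕ) : UniformHypergraph 3 (Fin (n + 1)) where
  edges := {e | e.card = 3 ∧ 0 ∈ e}
  card_eq := fun _ he => he.1

/-- The Ramsey number `r(H₁, H₂)`: the smallest positive integer `N` such that for every `k`-graph
`G` on `N` vertices, either `G` contains `H₁` or the complement of `G` contains `H₂`. -/
noncomputable def ramseyNumber {k : ℕ} {V W : Type*} (H₁ : UniformHypergraph k V)
    (H₂ : UniformHypergraph k W) : ℕ :=
  sInf {N : ℕ | 0 < N ∧ ∀ G : UniformHypergraph k (Fin N), G.Contains H₁ ∨ G.compl.Contains H₂}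

end UniformHypergraph

/-!
Call the edges of a `3`-graph red and the non-edges blue. A blue star with `n` leaves is a vertex `v`
with an independent set of size `n` in the link graph of `v` (`compl_contains_star_iff`), so both
upper bounds concern `3`-graphs whose links have no independent set of size `n`, and both lower bounds
construct such `3`-graphs without a red clique.

**Upper bound for `K_s`.** Grow a red clique `K` and a large set `S` such that every pair in `K` is red
with every vertex of `S`, and for each `v ∈ K` a set `B v` of leaves of a blue star centred at `v` that
every vertex of `S` may extend. A vertex `x ∈ S` goes to `K` if the triples `v x w` with `v ∈ K` are red
for many `w ∈ S`, and to some `B v` otherwise. Either costs a factor of about `s` in the size of `S`,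
and it happens at most `s * n` times (`contains_complete_of_state`).

**Upper bound for `K₄`.** Let `m ≈ n ^ (1 / 3)`. By Ramsey's theorem for graphs and the pigeonhole
principle, many vertices `B` share a red `m`-clique `A` in their links. As there is no red `K₄`, the
links of the vertices of `A` are edge-disjoint on `B`, so one of them has density at most `1 / m`
there. It has no independent set of size `n`, nor a clique of size `n`, as the latter would be
independent in the link of another vertex of `A`. By the Erdős–Szemerédi theorem
(`SimpleGraph.card_le_of_density`), `B` has at most `n ^ O(n / m)` vertices. The total is
`n ^ O(m ^ 2 + n / m)`.

**Lower bound for `K₅`.** Colour the pairs of an ordered set at random with two colours, and let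
`a < b < c` be red if `ab` and `bc` have different colours (`stepGraph`).

**Lower bound for `K₄`.** The vertices are polynomials `v` of degree less than `k` over a field with
`q = 2 ^ (8 * k)` elements, and `S v` is the graph of `v`, so that `S u ∩ S v` has at most `k` points
for `u ≠ v`. A random asymmetric relation `D` on the plane has the property that each `S w` contains a
point dominating all of `S u ∩ S v` (`exists_dominating_relation`). Give each pair a random colour in
`ℤ/3` and a random point of the plane as its label. A triple is red if two of its pairs have the same
colour `c`, the third one, its base, has colour `c + 1`, and the label of the base `ab` lies in `S w`
for the third vertex `w` and dominates `S a ∩ S b` (`baseGraph`). The colours force the bases in a red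
`K₄` to be two disjoint pairs `ab` and `cd`. The label of `ab` then lies in `S c ∩ S d` and that of `cd`
in `S a ∩ S b`, so the labels dominate each other, which is impossible. Conversely each pair of leaves
joined in the same colour to the centre of a star has a chance of at least `1 / (3 * q ^ 2)` to be a
base, so the links have no independent set of size polynomial in `q`, while there are `q ^ k` vertices.

Both random constructions use the same union bound, `exists_forall_exists_block_eq`.
-/

/-! ### Links, cliques and stars -/

namespace UniformHypergraph

variable {V W : Type*}

/-- The link of a vertex `v` in a `3`-graph: the graph whose edges are the pairs that form an edge
together with `v`. The vertex `v` itself is isolated in it. -/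
def link [DecidableEq V] (G : UniformHypergraph 3 V) (v : V) : SimpleGraph V where
  Adj a b := {v, a, b} ∈ G.edges
  symm := ⟨fun a b h => by rwa [Finset.pair_comm]⟩
  loopless := ⟨fun a h => by
    have h3 := G.card_eq _ h
    have h2 := Finset.card_le_two (a := v) (b := a)
    rw [Finset.pair_eq_singleton] at h3
    omega⟩

theorem link_adj [DecidableEq V] {G : UniformHypergraph 3 V} {v a b : V} :
    (G.link v).Adj a b ↔ {v, a, b} ∈ G.edges := Iff.rfl

/-- Adjacency in a link may be read with the first two vertices exchanged. -/
theorem link_adj_swap [DecidableEq V] {G : UniformHypergraph 3 V} {v a b : V} :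
    (G.link v).Adj a b ↔ (G.link a).Adj v b := by
  rw [link_adj, link_adj, Finset.insert_comm]

theorem contains_complete_iff [DecidableEq V] {G : UniformHypergraph 3 V} {s : ℕ} :
    G.Contains (complete 3 s) ↔ ∃ K : Finset V, K.card = s ∧
      ∀ a ∈ K, ∀ b ∈ K, ∀ c ∈ K, a ≠ b → a ≠ c → b ≠ c → {a, b, c} ∈ G.edges := by
  constructor
  · rintro ⟨f, hf⟩
    refine ⟨Finset.univ.map f, by simp, ?_⟩
    simp only [Finset.mem_map, Finset.mem_univ, true_and]
    rintro _ ⟨i, rfl⟩ _ ⟨j, rfl⟩ _ ⟨k, rfl⟩ hij hik hjk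
    have := hf {i, j, k} (Finset.card_eq_three.2 ⟨i, j, k, fun h => hij (h ▸ rfl),
      fun h => hik (h ▸ rfl), fun h => hjk (h ▸ rfl), rfl⟩)
    simpa [Finset.map_insert] using this
  · rintro ⟨K, hK, h⟩
    let g : Fin s ↪ V := (K.equivFinOfCardEq hK).symm.toEmbedding.trans (Function.Embedding.subtype _)
    have hg : ∀ i, g i ∈ K := fun i => ((K.equivFinOfCardEq hK).symm i).2
    refine ⟨g, fun e he => ?_⟩
    obtain ⟨i, j, k, hij, hik, hjk, rfl⟩ := Finset.card_eq_three.1 he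
    simpa [Finset.map_insert] using h _ (hg i) _ (hg j) _ (hg k) (g.injective.ne hij)
      (g.injective.ne hik) (g.injective.ne hjk)

theorem compl_contains_star_iff [DecidableEq V] {G : UniformHypergraph 3 V} {n : ℕ} :
    G.compl.Contains (star n) ↔
      ∃ v, ∃ L : Finset V, v ∉ L ∧ L.card = n ∧ (G.link v).IsIndepSet L := by
  constructor
  · rintro ⟨f, hf⟩
    refine ⟨f 0, (Finset.univ.erase 0).map f, by simp, by simp, ?_⟩
    intro a ha b hb hab
    simp only [Finset.coe_map, Set.mem_image, Finset.mem_coe, Finset.mem_erase,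
      Finset.mem_univ, and_true] at ha hb
    obtain ⟨i, hi, rfl⟩ := ha
    obtain ⟨j, hj, rfl⟩ := hb
    have := hf {0, i, j} ⟨Finset.card_eq_three.2 ⟨0, i, j, hi.symm, hj.symm,
      fun h => hab (h ▸ rfl), rfl⟩, by simp⟩
    have h2 := this.2
    simpa [Finset.map_insert, link_adj] using h2
  · rintro ⟨v, L, hv, hL, h⟩
    let g : Fin n ↪ V := (L.equivFinOfCardEq hL).symm.toEmbedding.trans (Function.Embedding.subtype _)
    have hg : ∀ i, g i ∈ L := fun i => ((L.equivFinOfCardEq hL).symm i).2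
    let f : Fin (n + 1) ↪ V := ⟨Fin.cons v g, Fin.cons_injective_iff.2
      ⟨by rintro ⟨i, hi⟩; exact hv (hi ▸ hg i), g.injective⟩⟩
    refine ⟨f, ?_⟩
    rintro e ⟨he, h0⟩
    refine ⟨by simpa using he, ?_⟩
    obtain ⟨i, j, hij, hE⟩ := Finset.card_eq_two.1
      (show (e.erase 0).card = 2 by rw [Finset.card_erase_of_mem h0, he])
    have h0i : i ≠ 0 := (Finset.mem_erase.1 (hE ▸ Finset.mem_insert_self i {j})).1
    have h0j : j ≠ 0 := (Finset.mem_erase.1 (hE ▸ by simp : j ∈ e.erase 0)).1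
    have he' : e = {0, i, j} := by rw [← hE, Finset.insert_erase h0]
    obtain ⟨i, rfl⟩ := Fin.exists_succ_eq.2 h0i
    obtain ⟨j, rfl⟩ := Fin.exists_succ_eq.2 h0j
    have : ¬ (G.link v).Adj (g i) (g j) :=
      h (hg i) (hg j) (g.injective.ne (fun h => hij (h ▸ rfl)))
    rw [link_adj] at this
    simpa [he', Finset.map_insert, f] using this

/-- Without a star in the complement, a set that avoids `v` and is independent in the link of `v`
is small. -/
theorem card_lt_of_isIndepSet_link [DecidableEq V] {G : UniformHypergraph 3 V} {n : ℕ}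
    (hG : ¬ G.compl.Contains (star n)) {v : V} {L : Finset V} (hv : v ∉ L)
    (hL : (G.link v).IsIndepSet L) : L.card < n := by
  by_contra! h
  obtain ⟨L', hL', hc⟩ := Finset.exists_subset_card_eq h
  exact hG (compl_contains_star_iff.2 ⟨v, L', fun h => hv (hL' h), hc,
    hL.mono (Finset.coe_subset.2 hL')⟩)

/-! ### The Ramsey number -/

/-- The hypergraph on `W` induced by `G` along an injection `f : W ↪ V`. -/
def comap {k : ℕ} (f : W ↪ V) (G : UniformHypergraph k V) : UniformHypergraph k W where
  edges := {e | e.map f ∈ G.edges}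
  card_eq e he := by simpa using G.card_eq _ he

theorem Contains.of_comap {k : ℕ} {U : Type*} {f : W ↪ V} {G : UniformHypergraph k V}
    {H : UniformHypergraph k U} (h : (G.comap f).Contains H) : G.Contains H := by
  obtain ⟨g, hg⟩ := h
  exact ⟨g.trans f, fun e he => by simpa [comap, Finset.map_map] using hg e he⟩

theorem compl_comap {k : ℕ} (f : W ↪ V) (G : UniformHypergraph k V) :
    (G.comap f).compl = G.compl.comap f := by
  ext e
  simp [comap, compl]

/-- A `3`-graph on a finite type that avoids both alternatives bounds from below every number with
the Ramsey property. -/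
theorem card_lt_of_not_contains [Fintype V] {k : ℕ} {U U' : Type*} {H₁ : UniformHypergraph k U}
    {H₂ : UniformHypergraph k U'} {G : UniformHypergraph k V} (h₁ : ¬ G.Contains H₁)
    (h₂ : ¬ G.compl.Contains H₂) {N : ℕ}
    (hN : ∀ G : UniformHypergraph k (Fin N), G.Contains H₁ ∨ G.compl.Contains H₂) :
    Fintype.card V < N := by
  by_contra! h
  obtain ⟨f⟩ : Nonempty (Fin N ↪ V) := Function.Embedding.nonempty_of_card_le (by simpa using h)
  rcases hN (G.comap f) with h | h
  · exact h₁ h.of_comap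
  · rw [compl_comap] at h
    exact h₂ h.of_comap

theorem ramseyNumber_le {k : ℕ} {U U' : Type*} {H₁ : UniformHypergraph k U}
    {H₂ : UniformHypergraph k U'} {N : ℕ} (h0 : 0 < N)
    (hN : ∀ G : UniformHypergraph k (Fin N), G.Contains H₁ ∨ G.compl.Contains H₂) :
    ramseyNumber H₁ H₂ ≤ N :=
  Nat.sInf_le ⟨h0, hN⟩

/-- The Ramsey property holds at the Ramsey number itself, once it holds at some `N`. The infimum
of the empty set would be `0`, so the hypothesis cannot be dropped. -/
theorem ramseyNumber_spec {k : ℕ} {U U' : Type*} {H₁ : UniformHypergraph k U}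
    {H₂ : UniformHypergraph k U'} {N : ℕ} (h0 : 0 < N)
    (hN : ∀ G : UniformHypergraph k (Fin N), G.Contains H₁ ∨ G.compl.Contains H₂) :
    ∀ G : UniformHypergraph k (Fin (ramseyNumber H₁ H₂)), G.Contains H₁ ∨ G.compl.Contains H₂ :=
  (Nat.sInf_mem (s := {N : ℕ | 0 < N ∧ ∀ G : UniformHypergraph k (Fin N),
    G.Contains H₁ ∨ G.compl.Contains H₂}) ⟨N, h0, hN⟩).2

/-! ### The exponential upper bound -/

/-- The greedy embedding with its state exposed for induction. The set `K` is a clique all of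
whose pairs form an edge with every vertex of `S`, and `B v`, for `v ∈ K`, is a set such that
`{v, u, w}` is a non-edge for all distinct `u ∈ B v` and `w ∈ B v ∪ S`. Moving a vertex
`x` from `S` either to `K` or to some `B v` shrinks `S` by a factor of at most `s`, up to the loss
of `x`, and only `s * n` such moves are possible. -/
theorem contains_complete_of_state [DecidableEq V] {G : UniformHypergraph 3 V} {s n : ℕ}
    (hn : 1 ≤ n) (hG : ¬ G.compl.Contains (star n)) (d : ℕ) :
    ∀ (S K : Finset V) (B : V → Finset V), Disjoint K S → (∀ v ∈ K, v ∉ B v) →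
      (∀ v ∈ K, Disjoint (B v) S) → K.card ≤ s →
      (∀ a ∈ K, ∀ b ∈ K, ∀ c ∈ K ∪ S, a ≠ b → a ≠ c → b ≠ c → (G.link a).Adj b c) →
      (∀ v ∈ K, ∀ u ∈ B v, ∀ w ∈ B v ∪ S, u ≠ w → ¬ (G.link v).Adj u w) →
      d + K.card + ∑ v ∈ K, (B v).card = s * n → (s + 1) ^ d ≤ S.card →
      G.Contains (complete 3 s) := by
  induction d with
  | zero =>
    intro S K B hKS hvB hBS hKs hred hblue hd hS
    have hB : ∀ v ∈ K, (B v).card + 1 ≤ n := fun v hv =>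
      card_lt_of_isIndepSet_link hG (hvB v hv) fun a ha b hb hab =>
        hblue v hv a ha b (Finset.mem_union_left _ hb) hab
    have h1 : K.card + ∑ v ∈ K, (B v).card ≤ K.card * n := by
      have := Finset.sum_le_sum hB
      simp only [Finset.sum_add_distrib, Finset.sum_const, smul_eq_mul, mul_one] at this
      omega
    have : K.card = s := by
      have : s * n ≤ K.card * n := by omega
      exact le_antisymm hKs (Nat.le_of_mul_le_mul_right this hn)
    refine contains_complete_iff.2 ⟨K, this, fun a ha b hb c hc => ?_⟩
    exact hred a ha b hb c (Finset.mem_union_left _ hc)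
  | succ d ih =>
    intro S K B hKS hvB hBS hKs hred hblue hd hS
    rcases hKs.lt_or_eq with hlt | heq
    swap
    · refine contains_complete_iff.2 ⟨K, heq, fun a ha b hb c hc => ?_⟩
      exact hred a ha b hb c (Finset.mem_union_left _ hc)
    have hSne : S.Nonempty := Finset.card_pos.1 (lt_of_lt_of_le (by positivity) hS)
    obtain ⟨x, hx⟩ := hSne
    have hxK : x ∉ K := fun h => Finset.disjoint_left.1 hKS h hx
    classical
    -- Every vertex of `S \ {x}` is joined to `x` in all the links of `K`, or not in some of them.
    let blue : V → Finset V := fun v => (S.erase x).filter fun w => ¬ (G.link v).Adj x w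
    let red : Finset V := (S.erase x).filter fun w => ∀ v ∈ K, (G.link v).Adj x w
    have hblueS : ∀ v, blue v ⊆ S := fun v =>
      (Finset.filter_subset _ _).trans (Finset.erase_subset _ _)
    have hredS : red ⊆ S := (Finset.filter_subset _ _).trans (Finset.erase_subset _ _)
    have hcover : S.erase x ⊆ red ∪ K.biUnion blue := by
      intro w hw
      by_cases h : ∀ v ∈ K, (G.link v).Adj x w
      · exact Finset.mem_union_left _ (Finset.mem_filter.2 ⟨hw, h⟩)
      · push Not at h
        obtain ⟨v, hv, h⟩ := h
        exact Finset.mem_union_right _ (Finset.mem_biUnion.2 ⟨v, hv, Finset.mem_filter.2 ⟨hw, h⟩⟩)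
    have hlarge : (s + 1) ^ d ≤ red.card ∨ ∃ v ∈ K, (s + 1) ^ d ≤ (blue v).card := by
      by_contra! hsmall
      have h1 := Finset.card_le_card hcover
      have h2 := Finset.card_union_le red (K.biUnion blue)
      have h3 : (K.biUnion blue).card ≤ K.card * (s + 1) ^ d :=
        Finset.card_biUnion_le_card_mul _ _ _ fun v hv => (hsmall.2 v hv).le
      have h4 : K.card * (s + 1) ^ d + (s + 1) ^ d ≤ s * (s + 1) ^ d := by
        rw [← Nat.succ_mul]
        exact Nat.mul_le_mul_right _ hlt
      rw [Finset.card_erase_of_mem hx] at h1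
      rw [pow_succ, mul_add] at hS
      have h5 : 1 ≤ (s + 1) ^ d := Nat.one_le_pow _ _ (by omega)
      have h6 := hsmall.1
      rw [mul_comm ((s + 1) ^ d) s] at hS
      omega
    rcases hlarge with hr | ⟨v, hv, hb⟩
    · refine ih red (insert x K) (Function.update B x ∅) ?_ ?_ ?_ ?_ ?_ ?_ ?_ hr
      · rw [Finset.disjoint_insert_left]
        exact ⟨by simp [red], hKS.mono_right hredS⟩
      · intro v hv
        by_cases h : v = x
        · subst h; simp
        · simpa [h] using hvB v (Finset.mem_of_mem_insert_of_ne hv h)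
      · intro v hv
        by_cases h : v = x
        · subst h; simp
        · simpa [h] using (hBS v (Finset.mem_of_mem_insert_of_ne hv h)).mono_right hredS
      · rw [Finset.card_insert_of_notMem hxK]; omega
      · intro a ha b hb c hc hab hac hbc
        have hxred : ∀ v ∈ K, ∀ w ∈ K ∪ red, v ≠ w → (G.link v).Adj x w := by
          intro v hv w hw hvw
          rcases Finset.mem_union.1 hw with hw | hw
          · exact ((hred v hv w hw x (Finset.mem_union_right _ hx) hvw
              (fun h => hxK (h ▸ hv)) (fun h => hxK (h ▸ hw)))).symm
          · exact (Finset.mem_filter.1 hw).2 v hv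
        by_cases hax : a = x
        · subst hax
          have hb' := Finset.mem_of_mem_insert_of_ne hb hab.symm
          rw [link_adj_swap]
          refine hxred b hb' c ?_ hbc
          rw [Finset.insert_union] at hc
          exact Finset.mem_of_mem_insert_of_ne hc hac.symm
        · have ha' := Finset.mem_of_mem_insert_of_ne ha hax
          by_cases hbx : b = x
          · subst hbx
            refine hxred a ha' c ?_ hac
            rw [Finset.insert_union] at hc
            exact Finset.mem_of_mem_insert_of_ne hc hbc.symm
          · have hb' := Finset.mem_of_mem_insert_of_ne hb hbx
            refine hred a ha' b hb' c ?_ hab hac hbc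
            by_cases hcx : c = x
            · exact Finset.mem_union_right _ (hcx ▸ hx)
            · rw [Finset.insert_union] at hc
              exact Finset.union_subset_union_right hredS (Finset.mem_of_mem_insert_of_ne hc hcx)
      · intro v hv u hu w hw
        by_cases h : v = x
        · subst h; simp at hu
        · simp only [Function.update_of_ne h] at hu hw
          exact hblue v (Finset.mem_of_mem_insert_of_ne hv h) u hu w
            (Finset.union_subset_union_right hredS hw)
      · have h1 : ∑ v ∈ K, (Function.update B x ∅ v).card = ∑ v ∈ K, (B v).card :=
          Finset.sum_congr rfl fun v hv => by
            rw [Function.update_of_ne (ne_of_mem_of_not_mem hv hxK)]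
        rw [Finset.card_insert_of_notMem hxK, Finset.sum_insert hxK, Function.update_self,
          Finset.card_empty, h1]
        omega
    · have hxB : x ∉ B v := fun h => Finset.disjoint_left.1 (hBS v hv) h hx
      refine ih (blue v) K (Function.update B v (insert x (B v))) (hKS.mono_right (hblueS v))
        ?_ ?_ hKs ?_ ?_ ?_ hb
      · intro u hu
        by_cases h : u = v
        · subst h
          simp only [Function.update_self, Finset.mem_insert, not_or]
          exact ⟨fun h => hxK (h ▸ hu), hvB u hu⟩
        · simpa [h] using hvB u hu
      · intro u hu
        by_cases h : u = v
        · subst h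
          simp only [Function.update_self, Finset.disjoint_insert_left]
          exact ⟨by simp [blue], (hBS u hu).mono_right (hblueS u)⟩
        · simpa [h] using (hBS u hu).mono_right (hblueS v)
      · intro a ha b hb c hc
        exact hred a ha b hb c (Finset.union_subset_union_right (hblueS v) hc)
      · intro v' hv' u hu w hw huw
        by_cases h : v' = v
        · subst h
          simp only [Function.update_self] at hu hw
          by_cases hux : u = x
          · subst hux
            rw [Finset.insert_union] at hw
            rcases Finset.mem_union.1 (Finset.mem_of_mem_insert_of_ne hw huw.symm) with hw | hw
            · rw [(G.link v').adj_comm]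
              exact hblue v' hv' w hw u (Finset.mem_union_right _ hx) huw.symm
            · exact (Finset.mem_filter.1 hw).2
          · refine hblue v' hv' u (Finset.mem_of_mem_insert_of_ne hu hux) w ?_ huw
            by_cases hwx : w = x
            · exact Finset.mem_union_right _ (hwx ▸ hx)
            · rw [Finset.insert_union] at hw
              exact Finset.union_subset_union_right (hblueS _)
                (Finset.mem_of_mem_insert_of_ne hw hwx)
        · simp only [Function.update_of_ne h] at hu hw
          exact hblue v' hv' u hu w (Finset.union_subset_union_right (hblueS v) hw) huw
      · have h1 : ∑ u ∈ K, (Function.update B v (insert x (B v)) u).card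
            = ∑ u ∈ K, (B u).card + 1 := by
          rw [← Finset.add_sum_erase _ _ hv, ← Finset.add_sum_erase _ (fun u => (B u).card) hv,
            Function.update_self, Finset.card_insert_of_notMem hxB,
            Finset.sum_congr rfl fun u hu => by
              rw [Function.update_of_ne (Finset.ne_of_mem_erase hu)]]
          ring
        rw [h1]
        omega

theorem contains_complete_or_star {s n : ℕ} (hn : 1 ≤ n)
    (G : UniformHypergraph 3 (Fin ((s + 1) ^ (s * n)))) :
    G.Contains (complete 3 s) ∨ G.compl.Contains (star n) := by
  by_contra! h
  exact h.1 (contains_complete_of_state hn h.2 (s * n) Finset.univ ∅ (fun _ => ∅)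
    (by simp) (by simp) (by simp) (by simp) (by simp) (by simp) (by simp) (by simp))

end UniformHypergraph

/-! ### Homogeneous sets in sparse graphs -/

namespace SimpleGraph

variable {V : Type*}

theorem exists_isIndepSet_card_max (H : SimpleGraph V) (S : Finset V) :
    ∃ I ⊆ S, H.IsIndepSet I ∧ ∀ J ⊆ S, H.IsIndepSet J → J.card ≤ I.card := by
  classical
  obtain ⟨I, hI, hmax⟩ := (S.powerset.filter fun I : Finset V => H.IsIndepSet (I : Set V)).exists_max_image
    Finset.card ⟨∅, by simp [IsIndepSet]⟩
  rw [Finset.mem_filter, Finset.mem_powerset] at hI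
  exact ⟨I, hI.1, hI.2, fun J hJ h => hmax J (by simp [hJ, h])⟩

theorem IsIndepSet.insert_of_not_adj {H : SimpleGraph V} {s : Set V} (hs : H.IsIndepSet s) {x : V}
    (hx : ∀ y ∈ s, ¬ H.Adj x y) : H.IsIndepSet (insert x s) :=
  hs.insert fun y hy _ => ⟨hx y hy, fun h => hx y hy h.symm⟩

/-- A crude form of the Erdős–Szekeres bound for Ramsey numbers. -/
theorem card_lt_of_isIndepSet_of_isClique (H : SimpleGraph V) {b : ℕ} (a : ℕ) :
    ∀ S : Finset V, (∀ I ⊆ S, H.IsIndepSet I → I.card ≤ b) →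
      (∀ K ⊆ S, H.IsClique K → K.card ≤ a) → S.card < (b + 1) ^ a := by
  classical
  induction a with
  | zero =>
    intro S _ hK
    have : S = ∅ := by
      by_contra h
      obtain ⟨x, hx⟩ := Finset.nonempty_iff_ne_empty.2 h
      simpa using hK {x} (by simpa using hx) (by simp [IsClique])
    simp [this]
  | succ a ih =>
    intro S hI hK
    obtain ⟨I, hIS, hind, hmax⟩ := H.exists_isIndepSet_card_max S
    have hnbr : ∀ v ∈ I, (S.filter (H.Adj v)).card ≤ (b + 1) ^ a - 1 := by
      intro v hv
      refine Nat.le_sub_one_of_lt (ih _ (fun J hJ => hI J (hJ.trans (Finset.filter_subset _ _))) ?_)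
      intro K hKv hKc
      have hvK : v ∉ K := fun h => H.irrefl (Finset.mem_filter.1 (hKv h)).2
      have := hK (insert v K) (Finset.insert_subset (hIS hv) (hKv.trans (Finset.filter_subset _ _)))
        (by
          rw [Finset.coe_insert]
          exact hKc.insert fun w hw _ => (Finset.mem_filter.1 (hKv hw)).2)
      rw [Finset.card_insert_of_notMem hvK] at this
      omega
    -- By maximality, every vertex outside `I` has a neighbour in `I`.
    have hcover : S ⊆ I ∪ I.biUnion fun v => S.filter (H.Adj v) := by
      intro x hx
      by_contra h
      simp only [Finset.mem_union, Finset.mem_biUnion, Finset.mem_filter, not_or, not_exists,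
        not_and] at h
      have := hmax (insert x I) (Finset.insert_subset hx hIS) (by
        rw [Finset.coe_insert]
        exact hind.insert_of_not_adj fun y hy hxy => h.2 y hy hx hxy.symm)
      rw [Finset.card_insert_of_notMem h.1] at this
      omega
    have h1 := (Finset.card_le_card hcover).trans (Finset.card_union_le _ _)
    have h2 := Finset.card_biUnion_le_card_mul _ _ _ hnbr
    have h3 := hI I hIS hind
    have h4 : I.card * ((b + 1) ^ a - 1) ≤ b * ((b + 1) ^ a - 1) := Nat.mul_le_mul_right _ h3
    obtain ⟨c, hc⟩ : ∃ c, (b + 1) ^ a = c + 1 :=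
      ⟨(b + 1) ^ a - 1, (Nat.sub_add_cancel (Nat.one_le_pow _ _ (by omega))).symm⟩
    rw [pow_succ, hc]
    rw [hc, Nat.add_sub_cancel] at h2 h4
    nlinarith

end SimpleGraph

theorem Finset.card_filter_powerset_card_le {α : Type*} (I : Finset α) (j : ℕ) :
    (I.powerset.filter fun J => J.card ≤ j).card ≤ (I.card + 1) ^ j := by
  classical
  have hsub : (I.powerset.filter fun J => J.card ≤ j) ⊆
      (Finset.range (j + 1)).biUnion fun i => I.powersetCard i := by
    intro J hJ
    simp only [Finset.mem_filter, Finset.mem_powerset, Finset.mem_biUnion, Finset.mem_range,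
      Finset.mem_powersetCard] at hJ ⊢
    exact ⟨J.card, by omega, hJ.1, rfl⟩
  calc _ ≤ ∑ i ∈ Finset.range (j + 1), (I.powersetCard i).card :=
        (Finset.card_le_card hsub).trans Finset.card_biUnion_le
    _ ≤ ∑ i ∈ Finset.range (j + 1), I.card ^ i * 1 ^ (j - i) * j.choose i := by
        refine Finset.sum_le_sum fun i hi => ?_
        rw [Finset.card_powersetCard, one_pow, mul_one]
        have h1 : 1 ≤ j.choose i := Nat.choose_pos (by simpa [Nat.lt_succ_iff] using hi)
        exact (Nat.choose_le_pow _ _).trans (Nat.le_mul_of_pos_right _ h1)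
    _ = (I.card + 1) ^ j := (add_pow _ _ _).symm

namespace SimpleGraph

variable {V : Type*}

/-- A quantitative Erdős–Szemerédi theorem: if a graph of density at most `1 / m` on `B` has neither
an independent set nor a clique of size `n`, then `B` has at most about `n ^ (16 * n / m)` vertices.

A maximum independent set `I` of low-degree vertices has few neighbours of a typical vertex, so many
vertices `x` have the same small neighbourhood `J` in `I`. An independent set of such vertices can
replace `J` in `I`, so its size is at most that of `J`, and the Erdős–Szekeres bound applies to
these vertices. -/
theorem card_le_of_density (H : SimpleGraph V) [DecidableRel H.Adj] {m n : ℕ} (hm : 1 ≤ m)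
    (B : Finset V) (hdens : m * ∑ x ∈ B, (B.filter (H.Adj x)).card ≤ B.card ^ 2)
    (hI : ∀ I ⊆ B, H.IsIndepSet I → I.card < n) (hK : ∀ K ⊆ B, H.IsClique K → K.card < n) :
    B.card ≤ 4 * n ^ (2 * (8 * n / m)) + 4 * n := by
  classical
  rcases B.eq_empty_or_nonempty with rfl | hB
  · simp
  have hBpos : 0 < B.card := Finset.card_pos.2 hB
  set j := 8 * n / m with hj
  set B₀ := B.filter fun x => m * (B.filter (H.Adj x)).card ≤ 2 * B.card with hB₀
  have hB₀B : B₀ ⊆ B := Finset.filter_subset _ _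
  have hB₀card : B.card ≤ 2 * B₀.card := by
    have h1 : B₀.card + (B.filter fun x => ¬ m * (B.filter (H.Adj x)).card ≤ 2 * B.card).card
      = B.card := Finset.card_filter_add_card_filter_not _
    set C := B.filter fun x => ¬ m * (B.filter (H.Adj x)).card ≤ 2 * B.card
    have h2 : C.card * (2 * B.card) ≤ B.card * B.card := by
      calc C.card * (2 * B.card) = ∑ x ∈ C, 2 * B.card := by simp
        _ ≤ ∑ x ∈ C, m * (B.filter (H.Adj x)).card :=
            Finset.sum_le_sum fun x hx => (not_le.1 (Finset.mem_filter.1 hx).2).le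
        _ ≤ ∑ x ∈ B, m * (B.filter (H.Adj x)).card :=
            Finset.sum_le_sum_of_subset (Finset.filter_subset _ _)
        _ ≤ B.card * B.card := by rw [← Finset.mul_sum, ← sq]; exact hdens
    have h3 : 2 * C.card ≤ B.card := by
      refine Nat.le_of_mul_le_mul_right ?_ hBpos
      linarith
    omega
  obtain ⟨I, hIB₀, hind, hmax⟩ := H.exists_isIndepSet_card_max B₀
  have hIn : I.card < n := hI I (hIB₀.trans hB₀B) hind
  have hIpos : 0 < I.card := by
    obtain ⟨x, hx⟩ : B₀.Nonempty := Finset.card_pos.1 (by omega)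
    exact lt_of_lt_of_le (by simp) (hmax {x} (by simpa using hx) (by simp [IsIndepSet]))
  set B₁ := (B₀ \ I).filter fun x => m * (I.filter (H.Adj x)).card ≤ 8 * I.card with hB₁
  have hB₁card : B.card ≤ 4 * B₁.card + 4 * n := by
    set C := B₀.filter fun x => ¬ m * (I.filter (H.Adj x)).card ≤ 8 * I.card with hC
    have h1 : B₀ ⊆ B₁ ∪ (I ∪ C) := by
      intro x hx
      simp only [hB₁, hC, Finset.mem_union, Finset.mem_filter, Finset.mem_sdiff]
      tauto
    have h2 : C.card * (8 * I.card) ≤ I.card * (2 * B.card) := by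
      calc C.card * (8 * I.card) = ∑ x ∈ C, 8 * I.card := by simp
        _ ≤ ∑ x ∈ C, m * (I.filter (H.Adj x)).card :=
            Finset.sum_le_sum fun x hx => (not_le.1 (Finset.mem_filter.1 hx).2).le
        _ ≤ ∑ x ∈ B, m * (I.filter (H.Adj x)).card :=
            Finset.sum_le_sum_of_subset ((Finset.filter_subset _ _).trans hB₀B)
        _ = ∑ y ∈ I, m * (B.filter (H.Adj y)).card := by
            rw [← Finset.mul_sum, ← Finset.mul_sum]
            congr 1
            refine (Finset.sum_card_bipartiteAbove_eq_sum_card_bipartiteBelow H.Adj).trans ?_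
            exact Finset.sum_congr rfl fun y _ =>
              congrArg Finset.card (Finset.filter_congr fun x _ => H.adj_comm x y)
        _ ≤ ∑ y ∈ I, 2 * B.card :=
            Finset.sum_le_sum fun y hy => (Finset.mem_filter.1 (hIB₀ hy)).2
        _ = I.card * (2 * B.card) := by simp
    have h3 : 4 * C.card ≤ B.card := by
      refine Nat.le_of_mul_le_mul_right ?_ (show 0 < 2 * I.card by omega)
      linarith
    have h4 := Finset.card_le_card h1
    have h5 := Finset.card_union_le B₁ (I ∪ C)
    have h6 := Finset.card_union_le I C
    omega
  have hfib : ∀ J ∈ I.powerset.filter (fun J => J.card ≤ j),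
      (B₁.filter fun x => I.filter (H.Adj x) = J).card ≤ n ^ j := by
    intro J hJ
    rw [Finset.mem_filter, Finset.mem_powerset] at hJ
    set B₂ := B₁.filter fun x => I.filter (H.Adj x) = J with hB₂
    have hB₂B₁ : B₂ ⊆ B₁ := Finset.filter_subset _ _
    have hB₁B₀ : B₁ ⊆ B₀ := (Finset.filter_subset _ _).trans Finset.sdiff_subset
    have hindep : ∀ I' ⊆ B₂, H.IsIndepSet I' → I'.card ≤ j := by
      intro I' hI' hI'ind
      have hnot : ∀ x ∈ I', ∀ y ∈ I \ J, ¬ H.Adj x y := by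
        intro x hx y hy hxy
        rw [Finset.mem_sdiff, ← (Finset.mem_filter.1 (hI' hx)).2, Finset.mem_filter] at hy
        exact hy.2 ⟨hy.1, hxy⟩
      have hdisj : Disjoint I' (I \ J) := by
        rw [Finset.disjoint_left]
        intro x hx hxI
        have := (Finset.mem_filter.1 (hB₂B₁ (hI' hx))).1
        exact (Finset.mem_sdiff.1 this).2 (Finset.mem_sdiff.1 hxI).1
      have := hmax (I' ∪ (I \ J)) (Finset.union_subset ((hI'.trans hB₂B₁).trans hB₁B₀)
        (Finset.sdiff_subset.trans hIB₀)) (by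
          intro x hx y hy hxy
          rw [Finset.mem_coe, Finset.mem_union] at hx hy
          rcases hx with hx | hx <;> rcases hy with hy | hy
          · exact hI'ind hx hy hxy
          · exact hnot x hx y hy
          · exact fun h => hnot y hy x hx h.symm
          · exact hind (Finset.sdiff_subset hx) (Finset.sdiff_subset hy) hxy)
      rw [Finset.card_union_of_disjoint hdisj, Finset.card_sdiff_of_subset hJ.1] at this
      have := Finset.card_le_card hJ.1
      omega
    have := Hᶜ.card_lt_of_isIndepSet_of_isClique (b := n - 1) j B₂
      (fun K hKB h => Nat.le_sub_one_of_lt (hK K ((hKB.trans (hB₂B₁.trans hB₁B₀)).trans hB₀B)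
        (by simpa using h)))
      (fun I' hI' h => hindep I' hI' (by simpa using h))
    rw [Nat.sub_add_cancel (by omega)] at this
    exact this.le
  have hmaps : ∀ x ∈ B₁, I.filter (H.Adj x) ∈ I.powerset.filter (fun J => J.card ≤ j) := by
    intro x hx
    rw [Finset.mem_filter, Finset.mem_powerset]
    refine ⟨Finset.filter_subset _ _, ?_⟩
    rw [hj, Nat.le_div_iff_mul_le hm, mul_comm]
    have := (Finset.mem_filter.1 hx).2
    omega
  have h1 := Finset.card_le_mul_card_image_of_maps_to hmaps (n ^ j) hfib
  have h2 : (I.powerset.filter (fun J => J.card ≤ j)).card ≤ n ^ j :=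
    (I.card_filter_powerset_card_le j).trans (Nat.pow_le_pow_left hIn _)
  have h3 : B₁.card ≤ n ^ (2 * j) := by
    rw [two_mul, pow_add]
    exact h1.trans (Nat.mul_le_mul_left _ h2)
  omega

end SimpleGraph

/-! ### The subexponential upper bound for `K₄` -/

namespace UniformHypergraph

variable {V : Type*}

/-- Four triples of the form of a rectangle: `{a, a'}` with `b` and `b'`, and `{b, b'}` with `a` and
`a'`, are all the triples on the four vertices. -/
theorem contains_complete_four [DecidableEq V] {G : UniformHypergraph 3 V} {a a' b b' : V}
    (haa' : a ≠ a') (hbb' : b ≠ b') (hab : a ≠ b) (hab' : a ≠ b') (ha'b : a' ≠ b) (ha'b' : a' ≠ b')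
    (h₁ : (G.link b).Adj a a') (h₂ : (G.link b').Adj a a') (h₃ : (G.link a).Adj b b')
    (h₄ : (G.link a').Adj b b') : G.Contains (complete 3 4) := by
  refine contains_complete_iff.2 ⟨{a, a', b, b'}, ?_, ?_⟩
  · simp [*]
  · have hsymm : ∀ {x y z}, (G.link x).Adj y z → (G.link x).Adj z y := fun h => h.symm
    have hswap : ∀ {x y z}, (G.link x).Adj y z → (G.link y).Adj x z := fun h => link_adj_swap.1 h
    simp only [Finset.mem_insert, Finset.mem_singleton, ← link_adj]
    rintro x hx y hy z hz hxy hxz hyz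
    grind

/-- If a red clique `A` lies in the links of all vertices of `B`, then the links of the vertices of
`A` are edge-disjoint on `B`, so one of them is sparse there. A clique in it is independent in the
link of another vertex of `A`. -/
theorem card_le_of_common_clique [DecidableEq V] {G : UniformHypergraph 3 V} {m n : ℕ} (hm : 2 ≤ m)
    (hG4 : ¬ G.Contains (complete 3 4)) (hG : ¬ G.compl.Contains (star n)) {A B : Finset V}
    (hA : A.card = m) (hAB : Disjoint A B) (hclique : ∀ w ∈ B, (G.link w).IsClique A) :
    B.card ≤ 4 * n ^ (2 * (8 * n / m)) + 4 * n := by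
  classical
  have hne : ∀ a ∈ A, ∀ b ∈ B, a ≠ b := fun a ha b hb h =>
    Finset.disjoint_left.1 hAB ha (h ▸ hb)
  have hdisj : ∀ a ∈ A, ∀ a' ∈ A, a ≠ a' → ∀ b ∈ B, ∀ b' ∈ B, (G.link a).Adj b b' →
      ¬ (G.link a').Adj b b' := by
    intro a ha a' ha' haa' b hb b' hb' h h'
    exact hG4 (contains_complete_four haa' h.ne (hne a ha b hb) (hne a ha b' hb') (hne a' ha' b hb)
      (hne a' ha' b' hb') (hclique b hb ha ha' haa') (hclique b' hb' ha ha' haa') h h')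
  have hsum : ∑ a ∈ A, m * ∑ x ∈ B, (B.filter ((G.link a).Adj x)).card ≤ ∑ a ∈ A, B.card ^ 2 := by
    rw [← Finset.mul_sum, Finset.sum_const, hA, smul_eq_mul, Finset.sum_comm]
    refine Nat.mul_le_mul_left _ ?_
    have : ∀ x ∈ B, ∑ a ∈ A, (B.filter ((G.link a).Adj x)).card ≤ B.card := by
      intro x hx
      rw [← Finset.card_biUnion]
      · exact Finset.card_le_card (Finset.biUnion_subset.2 fun a _ => Finset.filter_subset _ _)
      · intro a ha a' ha' haa'
        rw [Function.onFun, Finset.disjoint_left]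
        intro y hy hy'
        rw [Finset.mem_filter] at hy hy'
        exact hdisj a ha a' ha' haa' x hx y hy.1 hy.2 hy'.2
    calc _ ≤ ∑ x ∈ B, B.card := Finset.sum_le_sum this
      _ = B.card ^ 2 := by simp [sq]
  obtain ⟨a, ha, hdens⟩ := Finset.exists_le_of_sum_le (Finset.card_pos.1 (by omega)) hsum
  obtain ⟨a', ha', haa'⟩ := Finset.exists_mem_ne (by omega : 1 < A.card) a
  refine (G.link a).card_le_of_density (by omega) B hdens ?_ ?_
  · exact fun I hIB hI =>
      card_lt_of_isIndepSet_link hG (fun h => hne a ha a (hIB h) rfl) hI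
  · exact fun K hKB hK =>
      card_lt_of_isIndepSet_link hG (v := a') (fun h => hne a' ha' a' (hKB h) rfl)
        fun x hx y hy hxy => hdisj a ha a' ha' haa'.symm x (hKB hx) y (hKB hy) (hK hx hy hxy)

/-- Every vertex outside a set `U` of `n ^ m` vertices has a clique of size `m` inside `U` in its
link; there are at most `n ^ (m * m)` such cliques, and each is shared by few vertices. -/
theorem card_le_of_no_four_of_no_star [DecidableEq V] [Fintype V] {G : UniformHypergraph 3 V}
    {m n : ℕ} (hm : 2 ≤ m) (hn : 2 ≤ n) (hG4 : ¬ G.Contains (complete 3 4))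
    (hG : ¬ G.compl.Contains (star n)) :
    Fintype.card V ≤ n ^ m + (4 * n ^ (2 * (8 * n / m)) + 4 * n) * n ^ (m * m) := by
  classical
  rcases le_total (Fintype.card V) (n ^ m) with h | h
  · omega
  obtain ⟨U, -, hU⟩ := Finset.exists_subset_card_eq (s := (Finset.univ : Finset V)) h
  have hex : ∀ w, ∃ A ⊆ U, w ∉ U → A.card = m ∧ (G.link w).IsClique A := by
    intro w
    by_contra! hw
    have hwU : w ∉ U := (hw ∅ (by simp)).1
    have := (G.link w).card_lt_of_isIndepSet_of_isClique (b := n - 1) (m - 1) U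
      (fun I hI hind => Nat.le_sub_one_of_lt
        (card_lt_of_isIndepSet_link hG (fun h => hwU (hI h)) hind))
      (fun K hK hcl => by
        by_contra! hlt
        obtain ⟨A, hA, hAc⟩ := Finset.exists_subset_card_eq (show m ≤ K.card by omega)
        exact (hw A (hA.trans hK)).2 hAc (hcl.subset (Finset.coe_subset.2 hA)))
    rw [hU, Nat.sub_add_cancel (by omega)] at this
    exact absurd this (not_lt.2 (Nat.pow_le_pow_right (by omega) (by omega)))
  choose A hAU hA using hex
  have hmaps : ∀ w ∈ Uᶜ, A w ∈ U.powersetCard m := fun w hw =>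
    Finset.mem_powersetCard.2 ⟨hAU w, (hA w (Finset.mem_compl.1 hw)).1⟩
  have h1 := Finset.card_le_mul_card_image_of_maps_to hmaps
    (4 * n ^ (2 * (8 * n / m)) + 4 * n) (by
      intro A₀ hA₀
      rw [Finset.mem_powersetCard] at hA₀
      refine card_le_of_common_clique hm hG4 hG hA₀.2 ?_ ?_
      · refine Finset.disjoint_left.2 fun x hx hxB => ?_
        exact Finset.mem_compl.1 (Finset.mem_filter.1 hxB).1 (hA₀.1 hx)
      · intro w hw
        rw [Finset.mem_filter, Finset.mem_compl] at hw
        exact hw.2 ▸ (hA w hw.1).2)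
  have h2 : (U.powersetCard m).card ≤ n ^ (m * m) := by
    rw [Finset.card_powersetCard, hU, pow_mul]
    exact Nat.choose_le_pow _ _
  have h3 := Finset.card_add_card_compl U
  have h4 := h1.trans (Nat.mul_le_mul_left _ h2)
  omega

theorem contains_four_or_star {m n : ℕ} (hm : 2 ≤ m) (hn : 2 ≤ n)
    (G : UniformHypergraph 3 (Fin (n ^ (m * m + 2 * (8 * n / m) + 6)))) :
    G.Contains (complete 3 4) ∨ G.compl.Contains (star n) := by
  by_contra! h
  have h1 := card_le_of_no_four_of_no_star hm hn h.1 h.2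
  rw [Fintype.card_fin] at h1
  set j := 2 * (8 * n / m)
  have e1 : 4 * n ^ j ≤ n ^ (j + 3) := by
    rw [pow_add, mul_comm]
    exact Nat.mul_le_mul_left _ (by nlinarith [Nat.pow_le_pow_left hn 3])
  have e2 : 4 * n ≤ n ^ (j + 3) := by
    calc 4 * n ≤ n ^ 3 := by nlinarith [Nat.pow_le_pow_left hn 2]
      _ ≤ n ^ (j + 3) := Nat.pow_le_pow_right (by omega) (by omega)
  have e3 : n ^ m ≤ n ^ (j + 4) * n ^ (m * m) := by
    rw [← pow_add]
    exact Nat.pow_le_pow_right (by omega) (by nlinarith)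
  have e4 : n ^ (m * m + j + 6) = n ^ (j + 4) * n ^ (m * m) * n ^ 2 := by ring
  have e5 : 2 * n ^ (j + 3) ≤ n ^ (j + 4) := by
    rw [pow_succ n (j + 3), mul_comm]
    exact Nat.mul_le_mul_left _ hn
  have e6 : (4 * n ^ j + 4 * n) * n ^ (m * m) ≤ n ^ (j + 4) * n ^ (m * m) :=
    Nat.mul_le_mul_right _ (by omega)
  have e7 : 0 < n ^ (j + 4) * n ^ (m * m) := by positivity
  have e8 : n ^ (j + 4) * n ^ (m * m) * 4 ≤ n ^ (j + 4) * n ^ (m * m) * n ^ 2 :=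
    Nat.mul_le_mul_left _ (Nat.pow_le_pow_left hn 2)
  omega

end UniformHypergraph

/-! ### The union bound for random functions -/

section Counting

variable {I P : Type*} [Fintype I] [DecidableEq I] [Fintype P] [DecidableEq P]

/-- The probability that a random function `I → P` agrees with `τ` on none of the disjoint blocks
in `R`, each of size at most `s`, is at most `(1 - |P| ^ (-s)) ^ |R|`. -/
theorem card_filter_forall_block_ne_le [Nonempty P] (τ : I → P) (s : ℕ) (R : Finset (Finset I))
    (hdisj : (R : Set (Finset I)).PairwiseDisjoint id) (hs : ∀ B ∈ R, B.card ≤ s) :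
    ((Finset.univ.filter fun φ : I → P => ∀ B ∈ R, ∃ i ∈ B, φ i ≠ τ i).card : ℝ) ≤
      (1 - ((Fintype.card P : ℝ) ^ s)⁻¹) ^ R.card * Fintype.card (I → P) := by
  induction R using Finset.induction_on with
  | empty => simp
  | insert B R hBR ih =>
    have hR := ih (hdisj.subset (by simp)) fun C hC => hs C (Finset.mem_insert_of_mem hC)
    set A := Finset.univ.filter fun φ : I → P => ∀ B ∈ R, ∃ i ∈ B, φ i ≠ τ i with hA
    set M := A.filter fun φ => ∀ i ∈ B, φ i = τ i with hM
    have hins : (Finset.univ.filter fun φ : I → P => ∀ C ∈ insert B R, ∃ i ∈ C, φ i ≠ τ i)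
        = A.filter fun φ => ¬ ∀ i ∈ B, φ i = τ i := by
      ext φ
      simp only [hA, Finset.mem_filter, Finset.mem_univ, true_and, Finset.forall_mem_insert]
      push Not
      tauto
    have hsplit : M.card + (A.filter fun φ => ¬ ∀ i ∈ B, φ i = τ i).card = A.card :=
      Finset.card_filter_add_card_filter_not _
    -- Overwriting `φ` by `τ` on `B` does not affect the other blocks, and `φ` is recovered from
    -- the result and the values of `φ` on `B`.
    have hM' : A.card ≤ M.card * Fintype.card P ^ s := by
      have h1 : A.card ≤ (M ×ˢ (Finset.univ : Finset (B → P))).card := by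
        refine Finset.card_le_card_of_injOn
          (fun φ => (fun i => if i ∈ B then τ i else φ i, fun i => φ i)) ?_ ?_
        · intro φ hφ
          simp only [Finset.coe_product, Set.mem_prod, Finset.mem_coe, Finset.mem_univ, and_true,
            hM, hA, Finset.mem_filter, true_and] at hφ ⊢
          refine ⟨fun C hC => ?_, fun i hi => by simp [hi]⟩
          obtain ⟨i, hi, hne⟩ := hφ C hC
          have hdBC : Disjoint B C := hdisj (Finset.mem_insert_self _ _)
            (Finset.mem_insert_of_mem hC) (fun h => hBR (h ▸ hC))
          have hiB : i ∉ B := fun h => Finset.disjoint_left.1 hdBC h hi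
          exact ⟨i, hi, by simpa [hiB] using hne⟩
        · intro φ _ ψ _ h
          rw [Prod.mk.injEq] at h
          funext i
          by_cases hi : i ∈ B
          · exact congrFun h.2 ⟨i, hi⟩
          · simpa [hi] using congrFun h.1 i
      rw [Finset.card_product, Finset.card_univ, Fintype.card_fun, Fintype.card_coe] at h1
      exact h1.trans (Nat.mul_le_mul_left _
        (Nat.pow_le_pow_right Fintype.card_pos (hs B (Finset.mem_insert_self _ _))))
    have hP : (0 : ℝ) < (Fintype.card P : ℝ) ^ s := by
      have : 0 < Fintype.card P := Fintype.card_pos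
      positivity
    have hP1 : ((Fintype.card P : ℝ) ^ s)⁻¹ ≤ 1 := by
      refine inv_le_one_of_one_le₀ (one_le_pow₀ ?_)
      exact_mod_cast (Fintype.card_pos : 0 < Fintype.card P)
    have hM'' : (A.card : ℝ) * ((Fintype.card P : ℝ) ^ s)⁻¹ ≤ M.card := by
      rw [← div_eq_mul_inv, div_le_iff₀ hP]
      exact_mod_cast hM'
    have hsplit' : (M.card : ℝ) + ((A.filter fun φ => ¬ ∀ i ∈ B, φ i = τ i).card : ℝ) = A.card := by
      exact_mod_cast hsplit
    rw [hins, Finset.card_insert_of_notMem hBR, pow_succ, mul_right_comm]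
    calc ((A.filter fun φ => ¬ ∀ i ∈ B, φ i = τ i).card : ℝ)
        ≤ A.card * (1 - ((Fintype.card P : ℝ) ^ s)⁻¹) := by linarith
      _ ≤ _ := mul_le_mul_of_nonneg_right hR (by linarith)

/-- A function that, for each `e : E`, agrees with the target `τ e` on one of the disjoint blocks
in `ℬ e`, when the union bound over `E` permits it. -/
theorem exists_forall_exists_block_eq [Nonempty P] {E : Type*} [Fintype E]
    (ℬ : E → Finset (Finset I)) (τ : E → I → P) {s r : ℕ}
    (hdisj : ∀ e, (ℬ e : Set (Finset I)).PairwiseDisjoint id)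
    (hs : ∀ e, ∀ B ∈ ℬ e, B.card ≤ s) (hr : ∀ e, r ≤ (ℬ e).card)
    (hlt : (Fintype.card E : ℝ) * Real.exp (-(r / (Fintype.card P : ℝ) ^ s)) < 1) :
    ∃ φ : I → P, ∀ e, ∃ B ∈ ℬ e, ∀ i ∈ B, φ i = τ e i := by
  by_contra! hcon
  have hcover : (Finset.univ : Finset (I → P)) ⊆ Finset.univ.biUnion fun e : E =>
      Finset.univ.filter fun φ : I → P => ∀ B ∈ ℬ e, ∃ i ∈ B, φ i ≠ τ e i := by
    intro φ _
    obtain ⟨e, he⟩ := hcon φ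
    simp only [Finset.mem_biUnion, Finset.mem_filter, Finset.mem_univ, true_and]
    exact ⟨e, he⟩
  have hP1 : ((Fintype.card P : ℝ) ^ s)⁻¹ ≤ 1 := by
    refine inv_le_one_of_one_le₀ (one_le_pow₀ ?_)
    exact_mod_cast (Fintype.card_pos : 0 < Fintype.card P)
  have hP0 : 0 ≤ ((Fintype.card P : ℝ) ^ s)⁻¹ := by positivity
  have hev : ∀ e, ((Finset.univ.filter fun φ : I → P =>
      ∀ B ∈ ℬ e, ∃ i ∈ B, φ i ≠ τ e i).card : ℝ) ≤
      Real.exp (-(r / (Fintype.card P : ℝ) ^ s)) * Fintype.card (I → P) := by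
    intro e
    refine (card_filter_forall_block_ne_le (τ e) s (ℬ e) (hdisj e) (hs e)).trans ?_
    refine mul_le_mul_of_nonneg_right ?_ (by positivity)
    calc (1 - ((Fintype.card P : ℝ) ^ s)⁻¹) ^ (ℬ e).card
        ≤ (1 - ((Fintype.card P : ℝ) ^ s)⁻¹) ^ r :=
          pow_le_pow_of_le_one (by linarith) (by linarith) (hr e)
      _ ≤ (Real.exp (-((Fintype.card P : ℝ) ^ s)⁻¹)) ^ r :=
          pow_le_pow_left₀ (by linarith) (Real.one_sub_le_exp_neg _) _
      _ = Real.exp (-(r / (Fintype.card P : ℝ) ^ s)) := by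
          rw [← Real.exp_nat_mul]
          ring_nf
  have h1 : (Fintype.card (I → P) : ℝ) ≤
      ∑ e : E, Real.exp (-(r / (Fintype.card P : ℝ) ^ s)) * Fintype.card (I → P) := by
    refine le_trans ?_ (Finset.sum_le_sum fun e _ => hev e)
    exact_mod_cast (Finset.card_le_card hcover).trans Finset.card_biUnion_le
  rw [Finset.sum_const, Finset.card_univ, nsmul_eq_mul, ← mul_assoc] at h1
  have h2 : (0 : ℝ) < Fintype.card (I → P) := by exact_mod_cast Fintype.card_pos
  nlinarith

/-- A colouring of pairs that, for each of the targets `τ θ`, agrees with it on some pair inside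
every `m`-element set. -/
theorem exists_pair_coloring {V Θ : Type*} [Fintype V] [DecidableEq V] [Fintype Θ] [Nonempty P]
    (τ : Θ → Sym2 V → P) (m : ℕ)
    (hlt : (Fintype.card Θ : ℝ) * (Fintype.card V : ℝ) ^ m *
      Real.exp (-((m * (m - 1) / 2 : ℝ) / Fintype.card P)) < 1) :
    ∃ φ : Sym2 V → P, ∀ θ, ∀ L : Finset V, L.card = m →
      ∃ u ∈ L, ∃ v ∈ L, u ≠ v ∧ φ s(u, v) = τ θ s(u, v) := by
  obtain ⟨φ, hφ⟩ := exists_forall_exists_block_eq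
    (E := Θ × (Finset.univ : Finset V).powersetCard m) (s := 1) (r := m.choose 2)
    (fun e => ((e.2 : Finset V).offDiag.image (Function.uncurry Sym2.mk)).image fun p => {p}) (fun e => τ e.1)
    (by
      intro e B hB C hC hBC
      simp only [Finset.coe_image, Set.mem_image] at hB hC
      obtain ⟨p, -, rfl⟩ := hB
      obtain ⟨q, -, rfl⟩ := hC
      have hpq : p ≠ q := fun h => hBC (by rw [h])
      simpa [Function.onFun] using hpq)
    (by
      intro e B hB
      obtain ⟨p, -, rfl⟩ := Finset.mem_image.1 hB
      simp)
    (by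
      intro e
      rw [Finset.card_image_of_injective _ Finset.singleton_injective, Sym2.card_image_offDiag,
        (Finset.mem_powersetCard.1 e.2.2).2])
    (by
      refine lt_of_le_of_lt ?_ hlt
      rw [pow_one, Nat.cast_choose_two]
      refine mul_le_mul_of_nonneg_right ?_ (Real.exp_pos _).le
      rw [Fintype.card_prod, Fintype.card_coe, Finset.card_powersetCard, Finset.card_univ,
        Nat.cast_mul]
      refine mul_le_mul_of_nonneg_left ?_ (by positivity)
      exact_mod_cast Nat.choose_le_pow _ _)
  refine ⟨φ, fun θ L hL => ?_⟩
  obtain ⟨B, hB, h⟩ := hφ (θ, ⟨L, Finset.mem_powersetCard.2 ⟨Finset.subset_univ _, hL⟩⟩)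
  simp only [Finset.mem_image, Finset.mem_offDiag] at hB
  obtain ⟨_, ⟨⟨u, v⟩, ⟨hu, hv, huv⟩, rfl⟩, rfl⟩ := hB
  exact ⟨u, hu, v, hv, huv, h _ (Finset.mem_singleton_self _)⟩

end Counting

/-! ### An exponential lower bound for `K₅` -/

namespace UniformHypergraph

/-- The `3`-graph on a linear order whose edges are the triples `a < b < c` such that the colours of
`ab` and `bc` are different. -/
def stepGraph {V : Type*} [LinearOrder V] (φ : Sym2 V → Bool) : UniformHypergraph 3 V where
  edges := {e | ∃ a b c, a < b ∧ b < c ∧ e = {a, b, c} ∧ φ s(a, b) ≠ φ s(b, c)}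
  card_eq := by
    rintro _ ⟨a, b, c, hab, hbc, rfl, -⟩
    exact Finset.card_eq_three.2 ⟨a, b, c, hab.ne, (hab.trans hbc).ne, hbc.ne, rfl⟩

variable {V : Type*} [LinearOrder V] {φ : Sym2 V → Bool}

theorem mem_edges_stepGraph {a b c : V} (hab : a < b) (hbc : b < c) :
    {a, b, c} ∈ (stepGraph φ).edges ↔ φ s(a, b) ≠ φ s(b, c) := by
  constructor
  · rintro ⟨a', b', c', hab', hbc', he, h⟩
    have ha : a ∈ ({a', b', c'} : Finset V) := he ▸ by simp
    have hb : b ∈ ({a', b', c'} : Finset V) := he ▸ by simp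
    have hc : c ∈ ({a', b', c'} : Finset V) := he ▸ by simp
    simp only [Finset.mem_insert, Finset.mem_singleton] at ha hb hc
    have : a = a' ∧ b = b' ∧ c = c' := by
      rcases ha with rfl | rfl | rfl <;> rcases hb with rfl | rfl | rfl <;>
        rcases hc with rfl | rfl | rfl <;> grind
    obtain ⟨rfl, rfl, rfl⟩ := this
    exact h
  · exact fun h => ⟨a, b, c, hab, hbc, rfl, h⟩

/-- Among five vertices `0 < 1 < 2 < 3 < 4` the colours of the pairs `12`, `13`, `23` and `34` are
determined by that of `01`, and `13` and `34` get the same colour. -/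
theorem not_contains_five_stepGraph : ¬ (stepGraph φ).Contains (complete 3 5) := by
  rw [contains_complete_iff]
  rintro ⟨K, hK, h⟩
  let f := K.orderEmbOfFin hK
  have hf : ∀ i j k : Fin 5, i < j → j < k → φ s(f i, f j) ≠ φ s(f j, f k) := by
    intro i j k hij hjk
    have hij' : f i < f j := f.strictMono hij
    have hjk' : f j < f k := f.strictMono hjk
    rw [← mem_edges_stepGraph hij' hjk']
    exact h _ (K.orderEmbOfFin_mem hK i) _ (K.orderEmbOfFin_mem hK j) _ (K.orderEmbOfFin_mem hK k)
      hij'.ne (hij'.trans hjk').ne hjk'.ne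
  have h1 := hf 0 1 2 (by decide) (by decide)
  have h2 := hf 0 1 3 (by decide) (by decide)
  have h3 := hf 1 2 3 (by decide) (by decide)
  have h4 := hf 2 3 4 (by decide) (by decide)
  have h5 := hf 1 3 4 (by decide) (by decide)
  rw [← Bool.eq_not] at h1 h2 h3 h4 h5
  simp_all

/-- In a large star centred at `v`, many leaves lie on the same side of `v` and are joined to it in
the same colour. Non-edges then force that colour on all pairs of such leaves. -/
theorem not_compl_contains_star_stepGraph {m n : ℕ} (hn : 4 * m < n)
    (hφ : ∀ c : Bool, ∀ L : Finset V, L.card = m + 1 →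
      ∃ u ∈ L, ∃ v ∈ L, u ≠ v ∧ φ s(u, v) = c) :
    ¬ (stepGraph φ).compl.Contains (star n) := by
  rw [compl_contains_star_iff]
  rintro ⟨v, L, hv, hL, hind⟩
  obtain ⟨⟨side, c⟩, -, hcard⟩ := Finset.exists_lt_card_fiber_of_mul_lt_card_of_maps_to
    (s := L) (t := (Finset.univ : Finset (Bool × Bool))) (n := m)
    (f := fun u => (decide (u < v), φ s(v, u))) (fun _ _ => Finset.mem_univ _)
    (by rw [hL]; simpa using hn)
  obtain ⟨L', hL', hL'c⟩ := Finset.exists_subset_card_eq (Nat.succ_le_of_lt hcard)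
  obtain ⟨x, hx, y, hy, hxy, hxyc⟩ := hφ (!c) L' hL'c
  -- The two vertices may be taken in increasing order.
  obtain ⟨x, hx, y, hy, hxy, hxyc⟩ : ∃ x ∈ L', ∃ y ∈ L', x < y ∧ φ s(x, y) = !c := by
    rcases hxy.lt_or_gt with h | h
    · exact ⟨x, hx, y, hy, h, hxyc⟩
    · exact ⟨y, hy, x, hx, h, by rw [Sym2.eq_swap]; exact hxyc⟩
  have hx' := hL' hx
  have hy' := hL' hy
  rw [Finset.mem_filter, Prod.mk.injEq] at hx' hy'
  have hadj : ¬ ((stepGraph φ).link v).Adj x y := hind hx'.1 hy'.1 hxy.ne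
  cases side with
  | true =>
    have hyv : y < v := by simpa using hy'.2.1
    apply hadj
    rw [link_adj_swap, (link _ _).adj_comm, link_adj, mem_edges_stepGraph hxy hyv, hxyc,
      Sym2.eq_swap, hy'.2.2]
    simp
  | false =>
    have hvx : v < x := lt_of_le_of_ne (by simpa using hx'.2.1) (fun h => hv (h ▸ hx'.1))
    apply hadj
    rw [link_adj, mem_edges_stepGraph hvx hxy, hxyc, hx'.2.2]
    simp

theorem exists_no_five_no_star {q n : ℕ} (hq : 1 ≤ q) (hn : 16 * q < n) :
    ∃ G : UniformHypergraph 3 (Fin (2 ^ q)), ¬ G.Contains (complete 3 5) ∧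
      ¬ G.compl.Contains (star n) := by
  obtain ⟨φ, hφ⟩ := exists_pair_coloring (P := Bool) (V := Fin (2 ^ q)) (Θ := Bool)
    (fun c _ => c) (4 * q + 1) (by
      have hq' : (1 : ℝ) ≤ q := by exact_mod_cast hq
      rw [Fintype.card_fin, Fintype.card_bool]
      push_cast
      have h2 : (2 : ℝ) = Real.exp (Real.log 2) := (Real.exp_log (by norm_num)).symm
      have h3 : (2 : ℝ) * (2 ^ q) ^ (4 * q + 1) =
          Real.exp (Real.log 2 * (1 + q * (4 * q + 1))) := by
        rw [← pow_mul, ← pow_succ', Real.exp_mul, ← h2]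
        norm_cast
        ring_nf
      rw [h3, ← Real.exp_add, Real.exp_lt_one_iff]
      have hlog := Real.log_two_lt_d9
      have hx : (5 : ℝ) ≤ q * (4 * q + 1) := by nlinarith
      nlinarith)
  exact ⟨stepGraph φ, not_contains_five_stepGraph,
    not_compl_contains_star_stepGraph (m := 4 * q) (by omega) hφ⟩

end UniformHypergraph

/-! ### A superpolynomial lower bound for `K₄` -/

/-- The graph of the polynomial with coefficient vector `v`, as a subset of the affine plane. -/
noncomputable def polynomialGraph {F : Type*} [Field F] [Fintype F] [DecidableEq F] {k : ℕ} (v : Fin k → F) :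
    Finset (F × F) :=
  Finset.univ.image fun x => (x, (Polynomial.ofFn k v).eval x)

theorem card_polynomialGraph {F : Type*} [Field F] [Fintype F] [DecidableEq F] {k : ℕ}
    (v : Fin k → F) : (polynomialGraph v).card = Fintype.card F := by
  rw [polynomialGraph, Finset.card_image_of_injective _ fun x y h => congrArg Prod.fst h,
    Finset.card_univ]

theorem card_polynomialGraph_inter_le {F : Type*} [Field F] [Fintype F] [DecidableEq F] {k : ℕ}
    {u v : Fin k → F} (huv : u ≠ v) : (polynomialGraph u ∩ polynomialGraph v).card ≤ k := by
  set p := Polynomial.ofFn k u - Polynomial.ofFn k v with hp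
  have hp0 : p ≠ 0 := by
    rw [hp, sub_ne_zero]
    intro h
    apply huv
    funext i
    have := congrArg (fun q => q.coeff i) h
    simpa using this
  have hdeg : p.natDegree ≤ k := by
    refine (Polynomial.natDegree_sub_le _ _).trans (max_le ?_ ?_) <;>
    exact Polynomial.natDegree_le_of_degree_le (Polynomial.ofFn_degree_lt _).le
  calc (polynomialGraph u ∩ polynomialGraph v).card ≤ p.roots.toFinset.card := by
        refine Finset.card_le_card_of_injOn Prod.fst ?_ ?_
        · intro q hq
          simp only [polynomialGraph, Finset.coe_inter, Finset.coe_image, Finset.coe_univ,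
            Set.image_univ, Set.mem_inter_iff, Set.mem_range] at hq
          obtain ⟨⟨x, rfl⟩, y, hy⟩ := hq
          rw [Prod.mk.injEq] at hy
          obtain ⟨rfl, hy⟩ := hy
          rw [Finset.mem_coe, Multiset.mem_toFinset, Polynomial.mem_roots hp0, Polynomial.IsRoot, hp,
            Polynomial.eval_sub, hy, sub_self]
        · intro q hq q' hq' h
          simp only [polynomialGraph, Finset.coe_inter, Finset.coe_image, Finset.coe_univ,
            Set.image_univ, Set.mem_inter_iff, Set.mem_range] at hq hq'
          obtain ⟨⟨x, rfl⟩, -⟩ := hq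
          obtain ⟨⟨y, rfl⟩, -⟩ := hq'
          simp only at h
          rw [h]
    _ ≤ p.roots.card := Multiset.toFinset_card_le _
    _ ≤ k := (Polynomial.card_roots' p).trans hdeg

/-- An asymmetric relation on the ground set `T` of a set system with small intersections, such
that each set `S w` of the system contains a point dominating any given intersection of two
different sets. It is obtained by orienting pairs at random. -/
theorem exists_dominating_relation {V T : Type*} [Fintype V] [Fintype T] [DecidableEq T]
    (S : V → Finset T) {k l : ℕ} (hS : ∀ v, l + k ≤ (S v).card)
    (hinter : ∀ u v, u ≠ v → (S u ∩ S v).card ≤ k)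
    (hlt : (Fintype.card V : ℝ) ^ 3 * Real.exp (-(l / 2 ^ (2 * k + 1))) < 1) :
    ∃ D : T → T → Prop, (∀ i j, D i j → ¬ D j i) ∧
      ∀ u v w, u ≠ v → ∃ i ∈ S w, ∀ y ∈ S u, y ∈ S v → D i y := by
  classical
  -- The diagonal pair keeps the blocks of different points `i` distinct when `Y` is empty.
  let block : Finset T → T → Finset (T × T) := fun Y i => ({i} ×ˢ insert i Y) ∪ (Y ×ˢ {i})
  have hblock : ∀ Y i p, p ∈ block Y i → i ∉ Y →
      (p.1 = i ∨ p.2 = i) ∧ (p.1 = i ∨ p.1 ∈ Y) ∧ (p.2 = i ∨ p.2 ∈ Y) := by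
    intro Y i p hp hi
    simp only [block, Finset.mem_union, Finset.mem_product, Finset.mem_singleton,
      Finset.mem_insert] at hp
    tauto
  have hdisj : ∀ Y i j, i ∉ Y → j ∉ Y → i ≠ j → Disjoint (block Y i) (block Y j) := by
    intro Y i j hi hj hij
    rw [Finset.disjoint_left]
    intro p hp hp'
    obtain ⟨h1, -, -⟩ := hblock Y i p hp hi
    obtain ⟨-, h2, h3⟩ := hblock Y j p hp' hj
    rcases h1 with rfl | rfl <;> tauto
  have hmem : ∀ Y i, (i, i) ∈ block Y i := fun Y i => by simp [block]
  obtain ⟨ψ, hψ⟩ := exists_forall_exists_block_eq (P := Bool) (I := T × T)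
    (E := {e : V × V × V // e.1 ≠ e.2.1}) (s := 2 * k + 1) (r := l)
    (fun e => (S e.1.2.2 \ (S e.1.1 ∩ S e.1.2.1)).image (block (S e.1.1 ∩ S e.1.2.1)))
    (fun e p => decide (p.2 ∈ S e.1.1 ∩ S e.1.2.1))
    (by
      intro e B hB C hC hBC
      simp only [Finset.coe_image, Set.mem_image, Finset.mem_coe, Finset.mem_sdiff] at hB hC
      obtain ⟨i, hi, rfl⟩ := hB
      obtain ⟨j, hj, rfl⟩ := hC
      exact hdisj _ i j hi.2 hj.2 fun h => hBC (by rw [h]))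
    (by
      intro e B hB
      obtain ⟨i, hi, rfl⟩ := Finset.mem_image.1 hB
      have h1 := hinter _ _ e.2
      refine (Finset.card_union_le _ _).trans ?_
      rw [Finset.card_product, Finset.card_product, Finset.card_singleton,
        Finset.card_insert_of_notMem (Finset.mem_sdiff.1 hi).2]
      omega)
    (by
      intro e
      rw [Finset.card_image_of_injOn]
      · have h1 := hinter _ _ e.2
        have h2 := hS e.1.2.2
        have h3 := Finset.le_card_sdiff (S e.1.1 ∩ S e.1.2.1) (S e.1.2.2)
        omega
      · intro i hi j hj hij
        by_contra hne
        have := hdisj _ i j (Finset.mem_sdiff.1 hi).2 (Finset.mem_sdiff.1 hj).2 hne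
        exact Finset.disjoint_left.1 this (hmem _ i) (hij ▸ hmem _ i))
    (by
      refine lt_of_le_of_lt ?_ hlt
      rw [Fintype.card_bool]
      push_cast
      refine mul_le_mul_of_nonneg_right ?_ (Real.exp_pos _).le
      have : Fintype.card {e : V × V × V // e.1 ≠ e.2.1} ≤ Fintype.card V ^ 3 := by
        refine (Fintype.card_subtype_le _).trans (le_of_eq ?_)
        rw [Fintype.card_prod, Fintype.card_prod]
        ring
      exact_mod_cast this)
  refine ⟨fun i j => ψ (i, j) = true ∧ ψ (j, i) = false, ?_, ?_⟩
  · rintro i j ⟨h, -⟩ ⟨-, h'⟩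
    simp [h] at h'
  · intro u v w huv
    obtain ⟨B, hB, h⟩ := hψ ⟨(u, v, w), huv⟩
    obtain ⟨i, hi, rfl⟩ := Finset.mem_image.1 hB
    rw [Finset.mem_sdiff] at hi
    refine ⟨i, hi.1, fun y hyu hyv => ?_⟩
    have hy : y ∈ S u ∩ S v := Finset.mem_inter.2 ⟨hyu, hyv⟩
    refine ⟨?_, ?_⟩
    · rw [h (i, y) (by simp [block, hyu, hyv])]
      exact decide_eq_true hy
    · rw [h (y, i) (by simp [block, hyu, hyv])]
      exact decide_eq_false hi.2

namespace UniformHypergraph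

/-- The triple `{a, b, w}` is an edge with base `{a, b}` and apex `w`: the pairs `aw` and `bw` have
the same colour `c ∈ ℤ/3`, the pair `ab` has colour `c + 1`, and the label of `ab` is a point of
`S w` that dominates `S a ∩ S b`. -/
def IsBase {V T : Type*} (S : V → Finset T) (D : T → T → Prop) (φ : Sym2 V → ZMod 3 × T)
    (a b w : V) : Prop :=
  (φ s(a, w)).1 = (φ s(b, w)).1 ∧ (φ s(a, b)).1 = (φ s(a, w)).1 + 1 ∧ (φ s(a, b)).2 ∈ S w ∧
    ∀ y ∈ S a, y ∈ S b → D (φ s(a, b)).2 y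

/-- The `3`-graph of all triples that have a base. -/
def baseGraph {V T : Type*} [DecidableEq V] (S : V → Finset T) (D : T → T → Prop)
    (φ : Sym2 V → ZMod 3 × T) : UniformHypergraph 3 V where
  edges := {e | ∃ a b w, a ≠ b ∧ a ≠ w ∧ b ≠ w ∧ e = {a, b, w} ∧ IsBase S D φ a b w}
  card_eq := by
    rintro _ ⟨a, b, w, hab, haw, hbw, rfl, -⟩
    exact Finset.card_eq_three.2 ⟨a, b, w, hab, haw, hbw, rfl⟩

variable {V T : Type*} {S : V → Finset T} {D : T → T → Prop} {φ : Sym2 V → ZMod 3 × T}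

theorem IsBase.symm {a b w : V} (h : IsBase S D φ a b w) : IsBase S D φ b a w := by
  obtain ⟨h1, h2, h3, h4⟩ := h
  refine ⟨h1.symm, ?_, ?_, ?_⟩
  · rw [Sym2.eq_swap, h2, h1]
  · rwa [Sym2.eq_swap]
  · intro y hb ha
    rw [Sym2.eq_swap]
    exact h4 y ha hb

theorem isBase_of_mem_baseGraph [DecidableEq V] {a b c : V} (hab : a ≠ b) (hac : a ≠ c)
    (hbc : b ≠ c) (h : {a, b, c} ∈ (baseGraph S D φ).edges) :
    IsBase S D φ a b c ∨ IsBase S D φ a c b ∨ IsBase S D φ b c a := by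
  obtain ⟨a', b', c', -, -, -, he, h⟩ := h
  have ha : a ∈ ({a', b', c'} : Finset V) := he ▸ by simp
  have hb : b ∈ ({a', b', c'} : Finset V) := he ▸ by simp
  have hc : c ∈ ({a', b', c'} : Finset V) := he ▸ by simp
  simp only [Finset.mem_insert, Finset.mem_singleton] at ha hb hc
  have h' := h.symm
  rcases ha with rfl | rfl | rfl <;> rcases hb with rfl | rfl | rfl <;>
    rcases hc with rfl | rfl | rfl <;> first | exact absurd rfl ‹_› | tauto

/-- Two disjoint pairs cannot be bases of triples with the vertices of the other pair as apexes:
their labels would dominate each other. -/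
theorem not_isBase_of_disjoint (hD : ∀ i j, D i j → ¬ D j i) {a b c d : V}
    (h₁ : IsBase S D φ a b c) (h₂ : IsBase S D φ a b d) (h₃ : IsBase S D φ c d a)
    (h₄ : IsBase S D φ c d b) : False :=
  hD _ _ (h₁.2.2.2 _ h₃.2.2.1 h₄.2.2.1) (h₃.2.2.2 _ h₁.2.2.1 h₂.2.2.1)

/-- The colour pattern of the triples with a base, with the first argument as the base. -/
def IsBaseColor (p q r : ZMod 3) : Prop := q = r ∧ p = q + 1

instance (p q r : ZMod 3) : Decidable (IsBaseColor p q r) := inferInstanceAs (Decidable (_ ∧ _))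

theorem IsBase.color {a b w : V} (h : IsBase S D φ a b w) :
    IsBaseColor (φ s(a, b)).1 (φ s(a, w)).1 (φ s(b, w)).1 := ⟨h.1, h.2.1⟩

set_option synthInstance.maxSize 2000 in
/-- In a colouring of the six pairs of four points by `ℤ/3` such that each triangle has a base
colour pattern, the bases are the two pairs of a perfect matching. -/
theorem zmod_three_matching : ∀ ab ac bc : ZMod 3,
    (IsBaseColor ab ac bc ∨ IsBaseColor ac ab bc ∨ IsBaseColor bc ab ac) → ∀ ad bd : ZMod 3,
    (IsBaseColor ab ad bd ∨ IsBaseColor ad ab bd ∨ IsBaseColor bd ab ad) → ∀ cd : ZMod 3,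
    (IsBaseColor ac ad cd ∨ IsBaseColor ad ac cd ∨ IsBaseColor cd ac ad) →
    (IsBaseColor bc bd cd ∨ IsBaseColor bd bc cd ∨ IsBaseColor cd bc bd) →
    (ab ≠ ac ∧ ab ≠ bc ∧ ab ≠ ad ∧ ab ≠ bd ∧ cd ≠ ac ∧ cd ≠ bc ∧ cd ≠ ad ∧ cd ≠ bd) ∨
    (ac ≠ ab ∧ ac ≠ bc ∧ ac ≠ ad ∧ ac ≠ cd ∧ bd ≠ ab ∧ bd ≠ bc ∧ bd ≠ ad ∧ bd ≠ cd) ∨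
    (ad ≠ ab ∧ ad ≠ bd ∧ ad ≠ ac ∧ ad ≠ cd ∧ bc ≠ ab ∧ bc ≠ bd ∧ bc ≠ ac ∧ bc ≠ cd) := by
  decide

theorem not_contains_four_baseGraph [DecidableEq V] (hD : ∀ i j, D i j → ¬ D j i) :
    ¬ (baseGraph S D φ).Contains (complete 3 4) := by
  rw [contains_complete_iff]
  rintro ⟨K, hK, h⟩
  obtain ⟨a, b, c, d, hab, hac, had, hbc, hbd, hcd, rfl⟩ := Finset.card_eq_four.1 hK
  have habc := isBase_of_mem_baseGraph hab hac hbc (h a (by simp) b (by simp) c (by simp) hab hac hbc)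
  have habd := isBase_of_mem_baseGraph hab had hbd (h a (by simp) b (by simp) d (by simp) hab had hbd)
  have hacd := isBase_of_mem_baseGraph hac had hcd (h a (by simp) c (by simp) d (by simp) hac had hcd)
  have hbcd := isBase_of_mem_baseGraph hbc hbd hcd (h b (by simp) c (by simp) d (by simp) hbc hbd hcd)
  have hcol : ∀ {x y z : V}, IsBase S D φ x y z ∨ IsBase S D φ x z y ∨ IsBase S D φ y z x →
      IsBaseColor (φ s(x, y)).1 (φ s(x, z)).1 (φ s(y, z)).1 ∨
      IsBaseColor (φ s(x, z)).1 (φ s(x, y)).1 (φ s(y, z)).1 ∨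
      IsBaseColor (φ s(y, z)).1 (φ s(x, y)).1 (φ s(x, z)).1 := by
    intro x y z h
    have e1 : s(y, x) = s(x, y) := Sym2.eq_swap
    have e2 : s(z, x) = s(x, z) := Sym2.eq_swap
    have e3 : s(z, y) = s(y, z) := Sym2.eq_swap
    rcases h with h | h | h
    · exact Or.inl h.color
    · exact Or.inr (Or.inl (e3 ▸ h.color))
    · refine Or.inr (Or.inr ?_)
      have := h.color
      rwa [e1, e2] at this
  -- A pair whose colour differs from those of the other two pairs of a triangle is its base.
  have hbase : ∀ {x y z : V}, IsBase S D φ x y z ∨ IsBase S D φ x z y ∨ IsBase S D φ y z x →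
      ((φ s(x, y)).1 ≠ (φ s(x, z)).1 → (φ s(x, y)).1 ≠ (φ s(y, z)).1 → IsBase S D φ x y z) ∧
      ((φ s(x, z)).1 ≠ (φ s(x, y)).1 → (φ s(x, z)).1 ≠ (φ s(y, z)).1 → IsBase S D φ x z y) ∧
      ((φ s(y, z)).1 ≠ (φ s(x, y)).1 → (φ s(y, z)).1 ≠ (φ s(x, z)).1 → IsBase S D φ y z x) := by
    intro x y z h
    have e1 : s(y, x) = s(x, y) := Sym2.eq_swap
    have e2 : s(z, x) = s(x, z) := Sym2.eq_swap
    have e3 : s(z, y) = s(y, z) := Sym2.eq_swap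
    rcases h with h | h | h
    · have h1 := h.1
      exact ⟨fun _ _ => h, fun _ h' => absurd h1 h', fun _ h' => absurd h1.symm h'⟩
    · have h1 := h.1
      rw [e3] at h1
      exact ⟨fun _ h' => absurd h1 h', fun _ _ => h, fun h' _ => absurd h1.symm h'⟩
    · have h1 := h.1
      rw [e1, e2] at h1
      exact ⟨fun h' _ => absurd h1 h', fun h' _ => absurd h1.symm h', fun _ _ => h⟩
  have Babc := hbase habc
  have Babd := hbase habd
  have Bacd := hbase hacd
  have Bbcd := hbase hbcd
  rcases zmod_three_matching _ _ _ (hcol habc) _ _ (hcol habd) _ (hcol hacd) (hcol hbcd) with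
    ⟨h1, h2, h3, h4, h5, h6, h7, h8⟩ | ⟨h1, h2, h3, h4, h5, h6, h7, h8⟩ |
    ⟨h1, h2, h3, h4, h5, h6, h7, h8⟩
  · exact not_isBase_of_disjoint hD (Babc.1 h1 h2) (Babd.1 h3 h4) (Bacd.2.2 h5 h7)
      (Bbcd.2.2 h6 h8)
  · exact not_isBase_of_disjoint hD (Babc.2.1 h1 h2) (Bacd.1 h3 h4) (Babd.2.2 h5 h7)
      (Bbcd.2.1 h6 h8)
  · exact not_isBase_of_disjoint hD (Babd.2.1 h1 h2) (Bacd.2.1 h3 h4) (Babc.2.2 h5 h7)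
      (Bbcd.1 h6 h8)

/-- Many leaves of a large star centred at `w` are joined to `w` in the same colour `c`. Some pair of
such leaves is coloured `c + 1` and labelled by a point that makes it a base with apex `w`. -/
theorem not_compl_contains_star_baseGraph [DecidableEq V] {m n : ℕ} (hn : 3 * m < n)
    {i : V → Sym2 V → T} (hi : ∀ w u v, u ≠ v → i w s(u, v) ∈ S w ∧
      ∀ y ∈ S u, y ∈ S v → D (i w s(u, v)) y)
    (hφ : ∀ (w : V) (c : ZMod 3), ∀ L : Finset V, L.card = m + 1 →
      ∃ u ∈ L, ∃ v ∈ L, u ≠ v ∧ φ s(u, v) = (c + 1, i w s(u, v))) :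
    ¬ (baseGraph S D φ).compl.Contains (star n) := by
  rw [compl_contains_star_iff]
  rintro ⟨w, L, hw, hL, hind⟩
  obtain ⟨c, -, hcard⟩ := Finset.exists_lt_card_fiber_of_mul_lt_card_of_maps_to
    (s := L) (t := (Finset.univ : Finset (ZMod 3))) (n := m)
    (f := fun u => (φ s(u, w)).1) (fun _ _ => Finset.mem_univ _)
    (by rw [hL, Finset.card_univ, ZMod.card]; exact hn)
  obtain ⟨L', hL', hL'c⟩ := Finset.exists_subset_card_eq (Nat.succ_le_of_lt hcard)
  obtain ⟨u, hu, v, hv, huv, huvc⟩ := hφ w c L' hL'c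
  have hu' := Finset.mem_filter.1 (hL' hu)
  have hv' := Finset.mem_filter.1 (hL' hv)
  have hadj : ¬ ((baseGraph S D φ).link w).Adj u v := hind hu'.1 hv'.1 huv
  apply hadj
  rw [link_adj]
  refine ⟨u, v, w, huv, fun h => hw (h ▸ hu'.1), fun h => hw (h ▸ hv'.1), ?_, ?_, ?_, ?_, ?_⟩
  · ext x
    simp only [Finset.mem_insert, Finset.mem_singleton]
    tauto
  · rw [hu'.2, hv'.2]
  · rw [huvc, hu'.2]
  · rw [huvc]
    exact (hi w u v huv).1
  · rw [huvc]
    exact (hi w u v huv).2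

/-- The choice of parameters: with `q = 2 ^ (8 * k)` there are `q ^ k` polynomials, any two of which
agree at fewer than `k` points, the palette has `3 * q ^ 2` colours, and sets of `6 * q ^ 3 + 1`
leaves suffice for the union bound over the colouring. -/
theorem exists_no_four_no_star {k n : ℕ} (hk : 1 ≤ k) (hn : 18 * 2 ^ (24 * k) < n) :
    ∃ (V : Type) (_ : Fintype V) (G : UniformHypergraph 3 V), Fintype.card V = 2 ^ (8 * k ^ 2) ∧
      ¬ G.Contains (complete 3 4) ∧ ¬ G.compl.Contains (star n) := by
  classical
  let F := GaloisField 2 (8 * k)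
  let _ : Fintype F := Fintype.ofFinite F
  have hF : Fintype.card F = 2 ^ (8 * k) := by
    rw [← Nat.card_eq_fintype_card]
    exact GaloisField.card 2 (8 * k) (by omega)
  have hV : Fintype.card (Fin k → F) = 2 ^ (8 * k ^ 2) := by
    rw [Fintype.card_fun, hF, Fintype.card_fin, ← pow_mul]
    ring_nf
  have hk' : (1 : ℝ) ≤ k := by exact_mod_cast hk
  have hlog := Real.log_two_lt_d9
  have hpow : ∀ j : ℕ, (2 : ℝ) ^ j = Real.exp (Real.log 2 * j) := by
    intro j
    rw [Real.exp_mul, Real.exp_log (by norm_num), Real.rpow_natCast]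
  have hB : (k : ℝ) + 1 ≤ 2 ^ k := by
    have := one_add_mul_le_pow (show (-2 : ℝ) ≤ 1 by norm_num) k
    norm_num at this
    linarith
  have hB64 : (64 : ℝ) * k ^ 2 ≤ 64 ^ k := by
    have h1 : (4 : ℝ) * k ≤ (2 ^ k) ^ 2 := by nlinarith
    calc (64 : ℝ) * k ^ 2 ≤ (4 * k) ^ 3 := by nlinarith [sq_nonneg (k : ℝ)]
      _ ≤ ((2 ^ k) ^ 2) ^ 3 := pow_le_pow_left₀ (by positivity) h1 3
      _ = 64 ^ k := by
        rw [← pow_mul, ← pow_mul, mul_comm k, pow_mul]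
        norm_num
  have hcard : (Fintype.card (Fin k → F) : ℝ) = Real.exp (Real.log 2 * (8 * k ^ 2)) := by
    rw [hV]
    push_cast
    rw [hpow]
    push_cast
    rfl
  obtain ⟨D, hD, hdom⟩ := exists_dominating_relation (polynomialGraph (F := F) (k := k)) (k := k)
    (l := 2 ^ (8 * k) - k)
    (fun v => by
      rw [card_polynomialGraph, hF, Nat.sub_add_cancel]
      exact (Nat.lt_two_pow_self (n := k)).le.trans
        (Nat.pow_le_pow_right (by norm_num) (by omega)))
    (fun u v huv => card_polynomialGraph_inter_le huv)
    (by
      rw [hcard, ← Real.exp_nat_mul, ← Real.exp_add, Real.exp_lt_one_iff,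
        Nat.cast_sub ((Nat.lt_two_pow_self (n := k)).le.trans
          (Nat.pow_le_pow_right (by norm_num) (by omega)))]
      have h4 : (k : ℝ) ≤ 4 ^ k := by
        refine le_trans ?_ (pow_le_pow_left₀ (by norm_num) (by norm_num : (2 : ℝ) ≤ 4) k)
        linarith
      have h2 : ((2 : ℝ) ^ (8 * k)) = 64 ^ k * 4 ^ k := by
        rw [pow_mul, ← mul_pow]
        norm_num
      have h3 : (2 : ℝ) ^ (2 * k + 1) = 2 * 4 ^ k := by
        rw [pow_succ, pow_mul]
        norm_num [mul_comm]
      push_cast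
      rw [h2, h3]
      have h5 : (64 : ℝ) ^ k / 2 - 1 / 2 ≤ (64 ^ k * 4 ^ k - k) / (2 * 4 ^ k) := by
        rw [le_div_iff₀ (by positivity)]
        linarith
      nlinarith)
  have hex : ∀ w : Fin k → F, ∀ e : Sym2 (Fin k → F), ∃ i, ∀ u v, u ≠ v → e = s(u, v) →
      i ∈ polynomialGraph w ∧ ∀ y ∈ polynomialGraph u, y ∈ polynomialGraph v → D i y := by
    intro w e
    induction e using Sym2.ind with
    | _ u v =>
      by_cases huv : u = v
      · refine ⟨(0, 0), fun u' v' huv' he => ?_⟩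
        rw [Sym2.eq_iff] at he
        grind
      · obtain ⟨i, hi, h⟩ := hdom u v w huv
        refine ⟨i, fun u' v' _ he => ⟨hi, fun y hy hy' => ?_⟩⟩
        rw [Sym2.eq_iff] at he
        rcases he with ⟨rfl, rfl⟩ | ⟨rfl, rfl⟩
        · exact h y hy hy'
        · exact h y hy' hy
  choose i hi using hex
  obtain ⟨φ, hφ⟩ := exists_pair_coloring (P := ZMod 3 × (F × F)) (V := Fin k → F)
    (Θ := (Fin k → F) × ZMod 3) (fun θ e => (θ.2 + 1, i θ.1 e)) (6 * 2 ^ (24 * k) + 1) (by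
      have hz : (64 : ℝ) * k ^ 2 ≤ 2 ^ (8 * k) := by
        refine hB64.trans ?_
        rw [pow_mul]
        exact pow_le_pow_left₀ (by norm_num) (by norm_num) k
      have hz3 : (2 : ℝ) ^ (24 * k) = (2 ^ (8 * k)) ^ 3 := by
        rw [← pow_mul]
        ring_nf
      have h3 : (3 : ℝ) ≤ Real.exp 2 := by
        have := Real.add_one_le_exp (2 : ℝ)
        linarith
      rw [Fintype.card_prod, Fintype.card_prod, Fintype.card_prod, ZMod.card, hF]
      push_cast
      rw [hcard, hz3]
      set z : ℝ := 2 ^ (8 * k) with hzdef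
      have hz0 : 0 < z := by positivity
      have he : (6 * z ^ 3 + 1) * (6 * z ^ 3 + 1 - 1) / 2 / (3 * (z * z)) =
          (6 * z ^ 3 + 1) * z := by
        field_simp
        ring
      rw [he, ← Real.exp_nat_mul]
      push_cast
      rw [hz3]
      set M : ℝ := 6 * z ^ 3 + 1 with hM
      have hM1 : 1 ≤ M := by
        have : 0 < z ^ 3 := by positivity
        linarith
      have hkM : 1 ≤ (k : ℝ) ^ 2 * M := by nlinarith [mul_self_nonneg ((k : ℝ) - 1)]
      calc Real.exp (Real.log 2 * (8 * k ^ 2)) * 3 * Real.exp (M * (Real.log 2 * (8 * k ^ 2))) *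
            Real.exp (-(M * z))
          ≤ Real.exp (Real.log 2 * (8 * k ^ 2)) * Real.exp 2 *
            Real.exp (M * (Real.log 2 * (8 * k ^ 2))) * Real.exp (-(M * z)) := by gcongr
        _ < 1 := by
          rw [← Real.exp_add, ← Real.exp_add, ← Real.exp_add, Real.exp_lt_one_iff]
          have h6 : Real.log 2 * (8 * k ^ 2) ≤ 8 * k ^ 2 := by nlinarith
          have h7 : M * (Real.log 2 * (8 * k ^ 2)) ≤ M * (8 * k ^ 2) := by gcongr
          have h8 : M * (64 * k ^ 2) ≤ M * z := by gcongr
          have h9 : (k : ℝ) ^ 2 ≤ k ^ 2 * M := by nlinarith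
          linarith)
  exact ⟨Fin k → F, inferInstance, baseGraph polynomialGraph D φ, hV,
    not_contains_four_baseGraph hD,
    not_compl_contains_star_baseGraph (m := 6 * 2 ^ (24 * k)) (by omega)
      (fun w u v huv => hi w _ u v huv rfl) (fun w c => hφ (w, c))⟩

end UniformHypergraph

/-! ### Bounds for the Ramsey numbers -/

namespace UniformHypergraph

theorem Contains.complete_mono {V : Type*} {G : UniformHypergraph 3 V} {s t : ℕ} (hst : s ≤ t)
    (h : G.Contains (complete 3 t)) : G.Contains (complete 3 s) := by
  classical
  obtain ⟨K, hK, h⟩ := contains_complete_iff.1 h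
  obtain ⟨K', hK', hc⟩ := Finset.exists_subset_card_eq (hst.trans_eq hK.symm)
  exact contains_complete_iff.2 ⟨K', hc, fun a ha b hb c hc =>
    h a (hK' ha) b (hK' hb) c (hK' hc)⟩

theorem two_le_of_ramsey {s n N : ℕ} (hs : 2 ≤ s) (hn : 1 ≤ n)
    (hN : ∀ G : UniformHypergraph 3 (Fin N),
      G.Contains (complete 3 s) ∨ G.compl.Contains (star n)) : 2 ≤ N := by
  have hemb : ∀ t, 2 ≤ t → ¬ Nonempty (Fin t ↪ Fin 1) := by
    rintro t ht ⟨f⟩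
    have := Fintype.card_le_of_embedding f
    simp only [Fintype.card_fin] at this
    omega
  have h := card_lt_of_not_contains (V := Fin 1) (G := ⟨∅, by simp⟩) (H₁ := complete 3 s)
    (H₂ := star n) (fun ⟨f, _⟩ => hemb s hs ⟨f⟩) (fun ⟨f, _⟩ => hemb (n + 1) (by omega) ⟨f⟩) hN
  rw [Fintype.card_fin] at h
  exact h

theorem two_rpow_le_of_ramsey_four_star {n N : ℕ} (hn : 2 ≤ n)
    (hN : ∀ G : UniformHypergraph 3 (Fin N),
      G.Contains (complete 3 4) ∨ G.compl.Contains (star n)) :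
    (2 : ℝ) ^ (1 / 841 * Real.logb 2 n ^ 2) ≤ N := by
  set L := Real.logb 2 n with hL
  have hn0 : (0 : ℝ) < n := by positivity
  have hL0 : 0 ≤ L := Real.logb_nonneg (by norm_num) (by exact_mod_cast (by omega : 1 ≤ n))
  rcases lt_or_ge L 29 with h | h
  · calc (2 : ℝ) ^ (1 / 841 * L ^ 2) ≤ 2 ^ (1 : ℝ) :=
          Real.rpow_le_rpow_of_exponent_le (by norm_num) (by nlinarith)
      _ ≤ N := by
          rw [Real.rpow_one]
          exact_mod_cast two_le_of_ramsey (by norm_num) (by omega) hN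
  · set k := ⌊L / 29⌋₊ with hk
    have hk1 : 1 ≤ k := by
      rw [hk, Nat.one_le_floor_iff]
      linarith
    have hk1' : (1 : ℝ) ≤ k := by exact_mod_cast hk1
    have hkL : (29 : ℝ) * k ≤ L := by
      have := Nat.floor_le (show 0 ≤ L / 29 by positivity)
      rw [← hk] at this
      linarith
    have hLk : L ≤ 58 * k := by
      have := Nat.lt_floor_add_one (L / 29)
      rw [← hk] at this
      linarith
    have hpow : 2 ^ (29 * k) ≤ n := by
      have : (2 : ℝ) ^ ((29 * k : ℕ) : ℝ) ≤ n := by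
        rw [← Real.le_logb_iff_rpow_le (by norm_num) hn0]
        push_cast
        exact hkL
      rw [Real.rpow_natCast] at this
      exact_mod_cast this
    have hlt : 18 * 2 ^ (24 * k) < n := by
      refine lt_of_lt_of_le ?_ hpow
      rw [show 29 * k = 5 * k + 24 * k by ring, pow_add]
      refine Nat.mul_lt_mul_of_pos_right ?_ (by positivity)
      calc 18 < 2 ^ (5 * 1) := by norm_num
        _ ≤ 2 ^ (5 * k) := Nat.pow_le_pow_right (by norm_num) (by omega)
    obtain ⟨V, _, G, hV, h1, h2⟩ := exists_no_four_no_star hk1 hlt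
    have hcard := card_lt_of_not_contains h1 h2 hN
    rw [hV] at hcard
    calc (2 : ℝ) ^ (1 / 841 * L ^ 2) ≤ 2 ^ ((8 * k ^ 2 : ℕ) : ℝ) :=
          Real.rpow_le_rpow_of_exponent_le (by norm_num) (by push_cast; nlinarith)
      _ ≤ N := by
          rw [Real.rpow_natCast]
          exact_mod_cast hcard.le

theorem exists_ramsey_four_star_upper {n : ℕ} (hn : 2 ≤ n) :
    ∃ N : ℕ, 0 < N ∧ (∀ G : UniformHypergraph 3 (Fin N),
      G.Contains (complete 3 4) ∨ G.compl.Contains (star n)) ∧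
      (N : ℝ) ≤ 2 ^ (26 * (n : ℝ) ^ (2 / 3 : ℝ) * Real.logb 2 n) := by
  have hn1 : (1 : ℝ) < n := by exact_mod_cast (by omega : 1 < n)
  -- With `m ≈ n ^ (1 / 3)`, both terms `m ^ 2` and `n / m` of the exponent are `O(n ^ (2 / 3))`.
  set x : ℝ := (n : ℝ) ^ (1 / 3 : ℝ) with hx
  have hx1 : 1 < x := Real.one_lt_rpow hn1 (by norm_num)
  have hx2 : (n : ℝ) ^ (2 / 3 : ℝ) = x ^ 2 := by
    rw [hx, ← Real.rpow_mul_natCast (by positivity)]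
    norm_num
  have hx3 : (n : ℝ) = x ^ 3 := by
    rw [hx, ← Real.rpow_mul_natCast (by positivity)]
    norm_num
  set m := ⌈x⌉₊ with hm
  have hm2 : 2 ≤ m := Nat.succ_le_of_lt (Nat.lt_ceil.2 (by simpa using hx1))
  have hxm : x ≤ m := Nat.le_ceil x
  have hmx : (m : ℝ) ≤ 2 * x := by
    have := Nat.ceil_lt_add_one (show 0 ≤ x by linarith)
    rw [← hm] at this
    linarith
  refine ⟨_, by positivity, contains_four_or_star hm2 hn, ?_⟩
  have hj : ((8 * n / m : ℕ) : ℝ) ≤ 8 * x ^ 2 := by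
    refine Nat.cast_div_le.trans ?_
    rw [div_le_iff₀ (by linarith)]
    push_cast
    rw [hx3]
    nlinarith [sq_nonneg x]
  have hexp : ((m * m + 2 * (8 * n / m) + 6 : ℕ) : ℝ) ≤ 26 * x ^ 2 := by
    push_cast
    nlinarith
  push_cast
  rw [hx2, mul_comm (26 * x ^ 2), Real.rpow_mul (by norm_num),
    Real.rpow_logb (by norm_num) (by norm_num) (by linarith), ← Real.rpow_natCast]
  exact Real.rpow_le_rpow_of_exponent_le hn1.le hexp

theorem two_rpow_le_of_ramsey_complete_star {s n N : ℕ} (hs : 5 ≤ s) (hn : 1 ≤ n)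
    (hN : ∀ G : UniformHypergraph 3 (Fin N),
      G.Contains (complete 3 s) ∨ G.compl.Contains (star n)) :
    (2 : ℝ) ^ (1 / 32 * (n : ℝ)) ≤ N := by
  rcases le_or_gt n 32 with h | h
  · have h' : (n : ℝ) ≤ 32 := by exact_mod_cast h
    calc (2 : ℝ) ^ (1 / 32 * (n : ℝ)) ≤ 2 ^ (1 : ℝ) :=
          Real.rpow_le_rpow_of_exponent_le (by norm_num) (by linarith)
      _ ≤ N := by
          rw [Real.rpow_one]
          exact_mod_cast two_le_of_ramsey (by omega) hn hN
  · obtain ⟨G, h1, h2⟩ := exists_no_five_no_star (q := (n - 1) / 16) (n := n) (by omega) (by omega)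
    have hcard := card_lt_of_not_contains (fun h => h1 (h.complete_mono hs)) h2 hN
    rw [Fintype.card_fin] at hcard
    have hq : (n : ℝ) ≤ 32 * ((n - 1) / 16 : ℕ) := by
      exact_mod_cast (by omega : n ≤ 32 * ((n - 1) / 16))
    calc (2 : ℝ) ^ (1 / 32 * (n : ℝ)) ≤ 2 ^ (((n - 1) / 16 : ℕ) : ℝ) :=
          Real.rpow_le_rpow_of_exponent_le (by norm_num) (by linarith)
      _ ≤ N := by
          rw [Real.rpow_natCast]
          exact_mod_cast hcard.le

end UniformHypergraph

theorem theorem1p2 :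
    (∃ c c' : ℝ, 0 < c ∧ 0 < c' ∧ ∀ n : ℕ, 2 ≤ n →
      (2 : ℝ) ^ (c * Real.logb 2 n ^ 2) ≤
        (UniformHypergraph.ramseyNumber (UniformHypergraph.complete 3 4)
          (UniformHypergraph.star n) : ℝ) ∧
      (UniformHypergraph.ramseyNumber (UniformHypergraph.complete 3 4)
          (UniformHypergraph.star n) : ℝ) ≤
        (2 : ℝ) ^ (c' * (n : ℝ) ^ (2 / 3 : ℝ) * Real.logb 2 n)) ∧
    (∀ s : ℕ, 5 ≤ s → ∃ c c' : ℝ, 0 < c ∧ 0 < c' ∧ ∀ n : ℕ, 1 ≤ n →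
      (2 : ℝ) ^ (c * (n : ℝ)) ≤
        (UniformHypergraph.ramseyNumber (UniformHypergraph.complete 3 s)
          (UniformHypergraph.star n) : ℝ) ∧
      (UniformHypergraph.ramseyNumber (UniformHypergraph.complete 3 s)
          (UniformHypergraph.star n) : ℝ) ≤
        (2 : ℝ) ^ (c' * (n : ℝ))) := by
  open UniformHypergraph in
  constructor
  · refine ⟨1 / 841, 26, by norm_num, by norm_num, fun n hn => ?_⟩
    obtain ⟨N, h0, hN, hle⟩ := exists_ramsey_four_star_upper hn
    exact ⟨two_rpow_le_of_ramsey_four_star hn (ramseyNumber_spec h0 hN),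
      le_trans (by exact_mod_cast ramseyNumber_le h0 hN) hle⟩
  · intro s hs
    have hs1 : (1 : ℝ) < s + 1 := by exact_mod_cast (by omega : 1 < s + 1)
    refine ⟨1 / 32, s * Real.logb 2 (s + 1), by norm_num,
      mul_pos (by exact_mod_cast (by omega : 0 < s)) (Real.logb_pos (by norm_num) hs1),
      fun n hn => ?_⟩
    have h0 : 0 < (s + 1) ^ (s * n) := by positivity
    have hN := contains_complete_or_star (s := s) hn
    refine ⟨two_rpow_le_of_ramsey_complete_star hs hn (ramseyNumber_spec h0 hN), ?_⟩
    calc (ramseyNumber (complete 3 s) (star n) : ℝ) ≤ ((s + 1) ^ (s * n) : ℕ) := by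
          exact_mod_cast ramseyNumber_le h0 hN
      _ = 2 ^ (s * Real.logb 2 (s + 1) * n) := by
          rw [mul_comm (s : ℝ), mul_assoc, Real.rpow_mul (by norm_num),
            Real.rpow_logb (by norm_num) (by norm_num) (by linarith)]
          push_cast
          rw [← Real.rpow_natCast]
          push_cast
          rfl
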